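/- **Setting.** Let $\lambda>0$ be known, let $N$ be a Poisson random variable with parameter $\lambda$, and let $Y_1,Y_2,\dots$ be i.i.d. real random variables with probability density $f\ge 0$, independent of $N$. Put $X=\sum_{j=1}^{N}Y_j$. Let $X_1,X_2,\dots$ be independent copies of $X$ and let $Z_1,Z_2,\dots$ be the successive nonzero terms of this sequence (almost surely there are infinitely many). For an integrable function $v:\mathbb R\to\mathbb R$ write $\phi_v(t)=\int_{\mathbb R}e^{itu}v(u)\,du$. For a kernel $w$, a bandwidth $h=h_n>0$ and $M_n>0$ put $$\psi_n(t)=(e^\lambda-1)\,\phi_{\mathrm{emp}}(t)\,\phi_w(ht)+1,\qquad \phi_{\mathrm{emp}}(t)=\frac1n\sum_{j=1}^n e^{itZ_j}.$$ If $\psi_n(t)\neq 0$ for all $t\in\mathbb R$, let $\operatorname{Log}\psi_n$ be its distinguished logarithm, that is, the unique continuous $L:\mathbb R\to\mathbb C$ with $e^{L(t)}=\psi_n(t)$ for all $t$ and $L(0)=\lambda$ (note that $\psi_n(0)=e^\lambda$, since $\int w=1$ below), and put $$f_{nh}(x)=\frac1{2\pi\lambda}\int_{-1/h}^{1/h}e^{-itx}\operatorname{Log}\psi_n(t)\,dt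 ,$$ which is real; otherwise put $f_{nh}(x)=0$. The estimator is the truncation $\hat f_{nh}(x)=\max\{\min\{M_n,f_{nh}(x)\},-M_n\}$. **Assumptions.** Let $\beta,L_1,L_2>0$ and let $l=\lfloor\beta\rfloor$ be the integer part of $\beta$, with $f^{(0)}=f$. * (F) The derivatives of $f$ up to order $l$ exist; for all $x,t\in\mathbb R$, $|f^{(l)}(x+t)-f^{(l)}(x)|\le L_1|t|^{\beta-l}$; for all $t\in\mathbb R$, $\big[\int_{\mathbb R}(f^{(l)}(x+t)-f^{(l)}(x))^2dx\big]^{1/2}\le L_2|t|^{\beta-l}$; the function $|t|^\beta\phi_f(t)$ is integrable; and $f',\dots,f^{(l)}$ are integrable. * (W) $w:\mathbb R\to\mathbb R$ is bounded and symmetric ($w(-u)=w(u)$); $u^jw(u)$ is integrable for $j=0,\dots,l$; $\int w(u)\,du=1$; $\int u^jw(u)\,du=0$ for $j=1,\dots,l-1$; $\phi_w(t)=0$ for $|t|>1$; $\int|u|^\beta|w(u)|\,du<\infty$; $\lim_{|u|\to\infty}|u\,w(u)|=0$; and $\phi_w$ is continuously differentiable. * (H) $h_n=Cn^{-\gamma}$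 for all $n\ge1$, with constants $C>0$ and $0<\gamma<1$. * (M) $M_n=n^\alpha$ for all $n\ge 1$, with a constant $\alpha>0$. **Claim.** If (F), (W), (H), (M) hold and $n h_n^{1+4\beta}\to0$ as $n\to\infty$, then $\hat f_{nh}$ is pointwise weakly consistent: for every $x\in\mathbb R$, $\hat f_{nh}(x)\to f(x)$ in probability as $n\to\infty$, i.e. $P(|\hat f_{nh}(x)-f(x)|\ge\varepsilon)\to0$ for every $\varepsilon>0$. -/

import Mathlib

open MeasureTheory ProbabilityTheory Filter Topology

noncomputable section

/-- The characteristic function `t ↦ ∫ exp(i t u) v(u) du` of a real function `v`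
(a probability density, or a kernel that may take negative values). -/
def fnCharFun (v : ℝ → ℝ) (t : ℝ) : ℂ :=
  ∫ u : ℝ, Complex.exp ((t : ℂ) * (u : ℂ) * Complex.I) * (v u : ℂ)

/-- All derivatives of `f` up to order `l` exist (everywhere on the line). -/
def HasDerivsUpTo (l : ℕ) (f : ℝ → ℝ) : Prop :=
  ∀ k < l, Differentiable ℝ (iteratedDeriv k f)

/-- The Hölder class with smoothness `β` and constant `L`; here `l = ⌊β⌋₊` is the integer
part of `β`. -/
def HolderClass (β L : ℝ) (f : ℝ → ℝ) : Prop :=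
  HasDerivsUpTo ⌊β⌋₊ f ∧
    ∀ x t : ℝ, |iteratedDeriv ⌊β⌋₊ f (x + t) - iteratedDeriv ⌊β⌋₊ f x| ≤
      L * |t| ^ (β - (⌊β⌋₊ : ℝ))

/-- The Nikol'ski class with smoothness `β` and constant `L`: the `L²`-norm (with values in
`[0, ∞]`, so that no integrability is presupposed) of the increment of the `⌊β⌋`-th derivative
is at most `L |t| ^ (β - ⌊β⌋)`. -/
def NikolskiClass (β L : ℝ) (f : ℝ → ℝ) : Prop :=
  HasDerivsUpTo ⌊β⌋₊ f ∧
    ∀ t : ℝ, eLpNorm (fun x : ℝ => iteratedDeriv ⌊β⌋₊ f (x + t) - iteratedDeriv ⌊β⌋₊ f x)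
      2 volume ≤ ENNReal.ofReal (L * |t| ^ (β - (⌊β⌋₊ : ℝ)))

/-- The smoothness condition on the density `f` of the summands. -/
structure DensityCondition (β L₁ L₂ : ℝ) (f : ℝ → ℝ) : Prop where
  holder : HolderClass β L₁ f
  nikolski : NikolskiClass β L₂ f
  integrable_charFun : Integrable (fun t : ℝ => ((|t| ^ β : ℝ) : ℂ) * fnCharFun f t)
  integrable_derivs : ∀ k : ℕ, 1 ≤ k → k ≤ ⌊β⌋₊ → Integrable (iteratedDeriv k f)

/-- `w` is a kernel of order `l`. -/
structure IsKernelOfOrder (l : ℕ) (w : ℝ → ℝ) : Prop where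
  integrable_pow_mul : ∀ j ≤ l, Integrable (fun u : ℝ => u ^ j * w u)
  integral_eq_one : ∫ u : ℝ, w u = 1
  integral_pow_mul : ∀ j : ℕ, 1 ≤ j → j < l → ∫ u : ℝ, u ^ j * w u = 0

/-- The condition on the kernel function `w`. -/
structure KernelCondition (β : ℝ) (w : ℝ → ℝ) : Prop where
  bounded : ∃ B : ℝ, ∀ u, |w u| ≤ B
  symmetric : ∀ u, w (-u) = w u
  kernel : IsKernelOfOrder ⌊β⌋₊ w
  charFun_support : ∀ t : ℝ, 1 < |t| → fnCharFun w t = 0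
  integrable_rpow : Integrable (fun u : ℝ => |u| ^ β * |w u|)
  tendsto_zero : Tendsto (fun u : ℝ => |u * w u|) (cocompact ℝ) (𝓝 0)
  charFun_contDiff : ContDiff ℝ 1 (fnCharFun w)

/-- The condition on the bandwidth: `h n = C n ^ (-γ)` with `C > 0` and `0 < γ < 1`. -/
def BandwidthCondition (h : ℕ → ℝ) : Prop :=
  ∃ C γ : ℝ, 0 < C ∧ 0 < γ ∧ γ < 1 ∧ ∀ n : ℕ, 1 ≤ n → h n = C * (n : ℝ) ^ (-γ)

/-- The condition on the truncating sequence: `M n = n ^ α` with `α > 0`. -/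
def TruncationCondition (M : ℕ → ℝ) : Prop :=
  ∃ α : ℝ, 0 < α ∧ ∀ n : ℕ, 1 ≤ n → M n = (n : ℝ) ^ α

/-- `L` is the distinguished logarithm of the path `ψ`: the continuous logarithm of `ψ` along
the real line that starts at `t = 0` from the principal value. (Below, `ψ 0 = exp lam` is a
positive real number, so that `L 0 = lam`.) -/
structure IsDistinguishedLog (ψ L : ℝ → ℂ) : Prop where
  continuous : Continuous L
  at_zero : L 0 = Complex.log (ψ 0)
  exp_eq : ∀ t, Complex.exp (L t) = ψ t

open Classical in
/-- The distinguished logarithm of a path `ψ`; it exists and is unique when `ψ` is continuous and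
has no zero, and is used only for such paths. -/
def distinguishedLog (ψ : ℝ → ℂ) : ℝ → ℂ :=
  if H : ∃ L, IsDistinguishedLog ψ L then H.choose else 0

/-- The empirical characteristic function of the sample `z 0, …, z (n - 1)`. -/
def empCharFun (n : ℕ) (z : ℕ → ℝ) (t : ℝ) : ℂ :=
  (1 / (n : ℂ)) * ∑ j ∈ Finset.range n, Complex.exp ((t : ℂ) * (z j : ℂ) * Complex.I)

/-- The path `t ↦ (e ^ lam - 1) φ_emp(t) φ_w(h t) + 1`. -/
def empPath (lam : ℝ) (w : ℝ → ℝ) (h : ℝ) (n : ℕ) (z : ℕ → ℝ) (t : ℝ) : ℂ :=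
  ((Real.exp lam - 1 : ℝ) : ℂ) * (empCharFun n z t * fnCharFun w (h * t)) + 1

open Classical in
/-- The plug-in estimator before truncation; it is zero if the path vanishes somewhere. The
integral is a real number (substitute `-t` for `t`), and `re` only changes its type. -/
def rawEstimator (lam : ℝ) (w : ℝ → ℝ) (h : ℝ) (n : ℕ) (z : ℕ → ℝ) (x : ℝ) : ℝ :=
  if ∀ t : ℝ, empPath lam w h n z t ≠ 0 then
    ((1 / (2 * (Real.pi : ℂ) * (lam : ℂ))) *
      ∫ t in (-(1 / h))..(1 / h),
        Complex.exp (-((t : ℂ) * (x : ℂ) * Complex.I)) *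
          distinguishedLog (empPath lam w h n z) t).re
  else 0

/-- The estimator, truncated to `[-M, M]`. -/
def decompoundingEstimator (lam : ℝ) (w : ℝ → ℝ) (h M : ℝ) (n : ℕ) (z : ℕ → ℝ) (x : ℝ) : ℝ :=
  max (min M (rawEstimator lam w h n z x)) (-M)

/-- The random sum `Y 0 + … + Y (N - 1)`. -/
def randomSum {Ω : Type*} (N : Ω → ℕ) (Y : ℕ → Ω → ℝ) (ω : Ω) : ℝ :=
  ∑ j ∈ Finset.range (N ω), Y j ω

/-- The `k`-th nonzero observation (counted from `0`) in the sequence `X 0, X 1, …`. -/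
def nonzeroObs {Ω : Type*} (X : ℕ → Ω → ℝ) (k : ℕ) (ω : Ω) : ℝ :=
  X (Nat.nth (fun i => X i ω ≠ 0) k) ω

/-- `N` is Poisson with parameter `lam`, and `Y 0, Y 1, …` are independent random variables with
density `f`, independent (as a sequence) of `N`. -/
structure IsCompoundPoissonModel {Ω : Type*} [MeasurableSpace Ω] (P : Measure Ω)
    (lam : ℝ) (f : ℝ → ℝ) (N : Ω → ℕ) (Y : ℕ → Ω → ℝ) : Prop where
  law_count : HasLaw N (poissonMeasure lam.toNNReal) P
  law_summand : ∀ j, HasLaw (Y j) (volume.withDensity (fun y => ENNReal.ofReal (f y))) P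
  indep_summands : iIndepFun Y P
  indep_count : IndepFun N (fun ω j => Y j ω) P

end

/-! Let `q` be the law of `X` conditioned on `X ≠ 0`. The nonzero observations are pairwise
independent with law `q` (`map_nonzeroObs`, `indepFun_nonzeroObs`), and summing over the Poisson
count gives `(e^λ - 1) φ_q + 1 = exp (λ φ_f)` (`charFun_cond_randomSum`).

With `D = φ_emp - φ_q`, the estimated path is therefore `exp (λ φ_f) (1 + ρ)`, where `ρ` combines a
noise term `D(t) φ_w(ht)` and a bias term `φ_q(t) (φ_w(ht) - 1)`. Wherever `|ρ| ≤ 1/2` for all `t`,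
its distinguished logarithm is `λ φ_f + log (1 + ρ)`, with principal `log`. The estimation error
then splits into four parts (`abs_rawEstimator_sub_le`): - the truncation error of Fourier inversion
of `φ_f`, which vanishes because `φ_f` is integrable; - the bias `∫ |φ_q| |φ_w(ht) - 1|`, which
vanishes by dominated convergence because `φ_q` is integrable too; - the quadratic remainder `∫
|D|²` over `|t| ≤ 1/h`, of mean at most `2/(nh)`; - a linear term `∫ a D` with bounded weight `a`.
Its second moment is also `O(1/(nh))`, since integrability of `φ_q` saves a factor `1/h` over
Cauchy–Schwarz (`integral_norm_sq_weightedExp_le`).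

As `γ < 1`, `nh → ∞` and all four parts vanish. What remains is that `|ρ| ≤ 1/2` with probability
tending to one. The bias in `ρ` is uniformly small (`eventually_bias_le`). The noise is zero for
`|t| > 1/h`, and on `|t| ≤ 1/h` it is uniformly small
(`tendsto_measureReal_exists_norm_empDeviation`): smallness of `∫ |D|²` becomes uniform smallness
because `D` oscillates little at a fixed scale. Truncation at `M_n` cannot increase the error once
`M_n ≥ |f x|`. -/

open scoped FourierTransform

/-! ### Fourier transforms: continuity, decay, inversion -/

lemma fnCharFun_eq_fourier (v : ℝ → ℝ) (t : ℝ) :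
    fnCharFun v t = 𝓕 (fun u => (v u : ℂ)) (-(t / (2 * Real.pi))) := by
  rw [Real.fourier_real_eq_integral_exp_smul, fnCharFun]
  congr 1
  ext u
  rw [smul_eq_mul]
  congr 2
  push_cast
  have : (Real.pi : ℂ) ≠ 0 := by exact_mod_cast Real.pi_ne_zero
  field_simp

lemma norm_fnCharFun_le (v : ℝ → ℝ) (t : ℝ) : ‖fnCharFun v t‖ ≤ ∫ u, |v u| := by
  refine (norm_integral_le_integral_norm _).trans_eq ?_
  congr 1
  ext u
  rw [norm_mul, ← Complex.ofReal_mul, Complex.norm_exp_ofReal_mul_I, one_mul, Complex.norm_real,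
    Real.norm_eq_abs]

lemma continuous_fnCharFun {v : ℝ → ℝ} (hv : Integrable v) : Continuous (fnCharFun v) := by
  have h : Continuous (𝓕 (fun u => (v u : ℂ))) := by
    have := VectorFourier.fourierIntegral_continuous (μ := volume) (L := innerₗ ℝ)
      Real.continuous_fourierChar (by exact continuous_inner) (f := fun u => (v u : ℂ)) hv.ofReal
    exact this
  have : fnCharFun v = fun t => 𝓕 (fun u => (v u : ℂ)) (-(t / (2 * Real.pi))) :=
    funext (fnCharFun_eq_fourier v)
  rw [this]
  fun_prop

/-- Riemann–Lebesgue, transported through the rescaling by `-1/(2π)`. -/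
lemma tendsto_fnCharFun_cocompact (v : ℝ → ℝ) :
    Tendsto (fnCharFun v) (cocompact ℝ) (𝓝 0) := by
  have h := Real.zero_at_infty_fourier (fun u => (v u : ℂ))
  have : fnCharFun v = fun t => 𝓕 (fun u => (v u : ℂ)) (-(t / (2 * Real.pi))) :=
    funext (fnCharFun_eq_fourier v)
  rw [this]
  refine h.comp ?_
  have e : Topology.IsClosedEmbedding (fun t : ℝ => -(t / (2 * Real.pi))) := by
    have := (Homeomorph.mulRight₀ (-(2 * Real.pi)⁻¹) (by simp)).isClosedEmbedding
    convert this using 2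
    simp [div_eq_mul_inv]
  exact e.tendsto_cocompact

lemma fnCharFun_zero (v : ℝ → ℝ) : fnCharFun v 0 = ((∫ u, v u : ℝ) : ℂ) := by
  simp [fnCharFun, integral_complex_ofReal]

/-- Fourier inversion for a continuous density. -/
lemma integral_exp_mul_fnCharFun {v : ℝ → ℝ} (hc : Continuous v) (hv : Integrable v)
    (hφ : Integrable (fnCharFun v)) (x : ℝ) :
    ∫ t : ℝ, Complex.exp (-((t : ℂ) * (x : ℂ) * Complex.I)) * fnCharFun v t =
      2 * (Real.pi : ℂ) * (v x : ℂ) := by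
  have hpi : (2 * Real.pi) ≠ 0 := by positivity
  have h1 : (𝓕 (fun u => (v u : ℂ))) = fun s => fnCharFun v (s * (-(2 * Real.pi))) := by
    ext s
    rw [fnCharFun_eq_fourier]
    field_simp
  have hF : Integrable (𝓕 (fun u => (v u : ℂ))) := by
    rw [h1]
    exact hφ.comp_mul_right' (by simp)
  have hinv := hv.ofReal.fourierInv_fourier_eq hF (v := x) (Continuous.continuousAt (by fun_prop))
  rw [Real.fourierInv_eq_fourier_neg, Real.fourier_real_eq_integral_exp_smul, h1] at hinv
  -- The substitution `t = -2π s` converts Mathlib's normalisation of the inverse transform; its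
  -- Jacobian is the factor `2π`.
  have h2 := Measure.integral_comp_mul_right
    (fun t : ℝ => Complex.exp (-((t : ℂ) * (x : ℂ) * Complex.I)) * fnCharFun v t) (-(2 * Real.pi))
  have h3 : (fun s : ℝ => Complex.exp (↑(-2 * Real.pi * s * -x) * Complex.I) •
      fnCharFun v (s * (-(2 * Real.pi)))) = fun s : ℝ => Complex.exp
        (-(((s * (-(2 * Real.pi)) : ℝ) : ℂ) * (x : ℂ) * Complex.I)) *
        fnCharFun v (s * (-(2 * Real.pi))) := by
    ext s
    rw [smul_eq_mul]
    congr 2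
    push_cast
    ring
  rw [h3, h2] at hinv
  rw [← hinv, inv_neg, abs_neg, abs_of_pos (by positivity)]
  have : (Real.pi : ℂ) ≠ 0 := by exact_mod_cast Real.pi_ne_zero
  simp only [mul_inv_rev, Complex.real_smul, Complex.ofReal_mul, Complex.ofReal_inv,
    Complex.ofReal_ofNat]
  rw [← mul_assoc, show 2 * (Real.pi : ℂ) * ((Real.pi : ℂ)⁻¹ * 2⁻¹) = 1 by field_simp, one_mul]

/-- On `[-1, 1]` the transform is bounded by the `L¹` norm of `v`; outside, `|t| ^ β ≥ 1`, so the
weighted transform dominates it. -/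
lemma integrable_fnCharFun_of_rpow {v : ℝ → ℝ} {β : ℝ} (hβ : 0 ≤ β) (hv : Integrable v)
    (h : Integrable (fun t : ℝ => ((|t| ^ β : ℝ) : ℂ) * fnCharFun v t)) :
    Integrable (fnCharFun v) := by
  have hc := continuous_fnCharFun hv
  have hI : Integrable (fun t => (Set.Icc (-1 : ℝ) 1).indicator (fun _ => ∫ u, |v u|) t +
      ‖((|t| ^ β : ℝ) : ℂ) * fnCharFun v t‖) := by
    refine Integrable.add ?_ h.norm
    exact (integrable_indicator_iff measurableSet_Icc).2 (by simp [integrableOn_const_iff])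
  refine hI.mono' hc.aestronglyMeasurable (ae_of_all _ fun t => ?_)
  by_cases ht : t ∈ Set.Icc (-1 : ℝ) 1
  · rw [Set.indicator_of_mem ht]
    exact (norm_fnCharFun_le v t).trans (le_add_of_nonneg_right (norm_nonneg _))
  · rw [Set.indicator_of_notMem ht, zero_add, norm_mul, Complex.norm_real, Real.norm_eq_abs]
    have : 1 ≤ |t| := by
      by_contra! h'
      exact ht ⟨(abs_lt.1 h').1.le, (abs_lt.1 h').2.le⟩
    refine le_mul_of_one_le_left (norm_nonneg _) ?_
    exact (Real.one_le_rpow this hβ).trans (le_abs_self _)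

lemma HolderClass.continuous {β L : ℝ} {f : ℝ → ℝ} (hβ : 0 < β) (h : HolderClass β L f) :
    Continuous f := by
  rcases Nat.eq_zero_or_pos ⌊β⌋₊ with h0 | h0
  · have h2 := h.2
    rw [h0] at h2
    simp only [iteratedDeriv_zero, Nat.cast_zero, sub_zero] at h2
    rw [continuous_iff_continuousAt]
    intro x
    have h3 : Tendsto (fun y : ℝ => L * |y - x| ^ β) (𝓝 x) (𝓝 0) := by
      have : ContinuousAt (fun y : ℝ => L * |y - x| ^ β) x := by
        refine continuousAt_const.mul (ContinuousAt.rpow_const (by fun_prop) (Or.inr hβ.le))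
      simpa [ContinuousAt, Real.zero_rpow hβ.ne'] using this
    rw [ContinuousAt, tendsto_iff_dist_tendsto_zero]
    refine squeeze_zero (fun _ => dist_nonneg) (fun y => ?_) h3
    have := h2 x (y - x)
    rwa [add_sub_cancel] at this
  · have := h.1 0 h0
    rw [iteratedDeriv_zero] at this
    exact this.continuous

/-! ### The distinguished logarithm -/

lemma IsDistinguishedLog.unique {ψ L₁ L₂ : ℝ → ℂ} (h₁ : IsDistinguishedLog ψ L₁)
    (h₂ : IsDistinguishedLog ψ L₂) : L₁ = L₂ := by
  have key : ∀ t, ∃ n : ℤ, L₁ t = L₂ t + n * (2 * Real.pi * Complex.I) := fun t =>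
    Complex.exp_eq_exp_iff_exists_int.1 ((h₁.exp_eq t).trans (h₂.exp_eq t).symm)
  choose k hk using key
  have hpi : (2 * (Real.pi : ℂ) * Complex.I) ≠ 0 := Complex.two_pi_I_ne_zero
  have hcast : ∀ t, ((k t : ℝ) : ℂ) = (L₁ t - L₂ t) / (2 * Real.pi * Complex.I) := fun t => by
    rw [hk t]
    field_simp
    push_cast
    ring
  have hcont : Continuous fun t => (k t : ℝ) := by
    have : Continuous fun t => ((k t : ℝ) : ℂ) := by
      simp_rw [hcast]
      exact (h₁.continuous.sub h₂.continuous).div_const _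
    exact Complex.isUniformEmbedding_ofReal.isEmbedding.continuous_iff.2 this
  have hk' : Continuous k := Int.isClosedEmbedding_coe_real.isEmbedding.continuous_iff.2 hcont
  have h0 : k 0 = 0 := by
    have := hcast 0
    rw [h₁.at_zero, h₂.at_zero, sub_self, zero_div] at this
    exact_mod_cast this
  ext1 t
  rw [hk t, PreconnectedSpace.constant inferInstance hk' (x := t) (y := 0), h0]
  simp

lemma distinguishedLog_eq {ψ L : ℝ → ℂ} (h : IsDistinguishedLog ψ L) :
    distinguishedLog ψ = L := by
  have H : ∃ L, IsDistinguishedLog ψ L := ⟨L, h⟩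
  rw [distinguishedLog, dif_pos H]
  exact H.choose_spec.unique h

/-- The distinguished logarithm of a small multiplicative perturbation of `exp ∘ g`. -/
lemma distinguishedLog_exp_mul_one_add {g z : ℝ → ℂ} (hg : Continuous g) (hz : Continuous z)
    (hz1 : ∀ t, ‖z t‖ < 1) (hz0 : z 0 = 0) (hg0 : (g 0).im = 0) :
    distinguishedLog (fun t => Complex.exp (g t) * (1 + z t)) =
      fun t => g t + Complex.log (1 + z t) := by
  -- The factor `1 + z` never leaves the slit plane, so the principal logarithm is continuous along
  -- it.
  have hne : ∀ t, 1 + z t ∈ Complex.slitPlane := fun t =>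
    Complex.mem_slitPlane_of_norm_lt_one (hz1 t)
  refine distinguishedLog_eq ⟨?_, ?_, fun t => ?_⟩
  · exact hg.add ((continuous_const.add hz).clog hne)
  · simp only [hz0, add_zero, Complex.log_one, mul_one]
    rw [Complex.log_exp] <;> rw [hg0]
    · linarith [Real.pi_pos]
    · exact Real.pi_pos.le
  · rw [Complex.exp_add, Complex.exp_log (Complex.slitPlane_ne_zero (hne t))]

/-! ### Law and pairwise independence of the nonzero observations -/

section NonzeroObs

variable {Ω : Type*} {X : ℕ → Ω → ℝ}

/-- The σ-algebra generated by `X 0, …, X (i - 1)`. -/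
abbrev strictPast (X : ℕ → Ω → ℝ) (i : ℕ) : MeasurableSpace Ω :=
  ⨆ k ∈ {k : ℕ | k < i}, MeasurableSpace.comap (X k) inferInstance

open Classical in
/-- The number of nonzero terms among `X 0, …, X (i - 1)`. -/
noncomputable def nonzeroCount (X : ℕ → Ω → ℝ) (i : ℕ) (ω : Ω) : ℕ :=
  Nat.count (fun m => X m ω ≠ 0) i

lemma measurable_strictPast {k i : ℕ} (h : k < i) : Measurable[strictPast X i] (X k) :=
  Measurable.of_comap_le (le_iSup₂_of_le k h le_rfl)

lemma measurable_nonzeroCount {m i : ℕ} (h : m ≤ i) :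
    Measurable[strictPast X i] (nonzeroCount X m) := by
  induction m with
  | zero =>
    have : nonzeroCount X 0 = fun _ => 0 := by ext ω; simp [nonzeroCount]
    rw [this]
    exact @measurable_const _ _ _ (strictPast X i) _
  | succ m ih =>
    classical
    have : nonzeroCount X (m + 1) =
        fun ω => nonzeroCount X m ω + if X m ω ≠ 0 then 1 else 0 := by
      ext ω
      simp only [nonzeroCount, Nat.count_succ]
    rw [this]
    let _ := strictPast X i
    refine (ih (by omega)).add (Measurable.ite ?_ measurable_const measurable_const)
    exact measurable_strictPast (by omega) (measurableSet_singleton (0 : ℝ)).compl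

lemma nth_nonzero_eq {i k : ℕ} {ω : Ω} (hN : nonzeroCount X i ω = k) (hne : X i ω ≠ 0) :
    Nat.nth (fun m => X m ω ≠ 0) k = i := by
  classical
  rw [← hN, nonzeroCount]
  exact Nat.nth_count (p := fun m => X m ω ≠ 0) hne

lemma nonzeroCount_nth_of_lt {i k : ℕ} {ω : Ω} (h : k < nonzeroCount X i ω) :
    Nat.nth (fun m => X m ω ≠ 0) k < i ∧ X (Nat.nth (fun m => X m ω ≠ 0) k) ω ≠ 0 ∧
      nonzeroCount X (Nat.nth (fun m => X m ω ≠ 0) k) ω = k := by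
  classical
  have hcard : ∀ hf : (Set.ofPred fun m => X m ω ≠ 0).Finite, k < hf.toFinset.card := by
    intro hf
    refine h.trans_le ?_
    rw [nonzeroCount, Nat.count_eq_card_filter_range]
    exact Finset.card_le_card fun m hm => by simpa using (Finset.mem_filter.1 hm).2
  refine ⟨Nat.nth_lt_of_lt_count h, Nat.nth_mem k hcard, ?_⟩
  exact Nat.count_nth hcard

lemma nonzeroCount_nth_of_infinite {ω : Ω} (h : {m | X m ω ≠ 0}.Infinite) (k : ℕ) :
    X (Nat.nth (fun m => X m ω ≠ 0) k) ω ≠ 0 ∧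
      nonzeroCount X (Nat.nth (fun m => X m ω ≠ 0) k) ω = k := by
  classical
  exact ⟨Nat.nth_mem_of_infinite h k, Nat.count_nth_of_infinite h k⟩

variable [MeasurableSpace Ω] {P : Measure Ω}

lemma strictPast_le (hX : ∀ i, Measurable (X i)) (i : ℕ) : strictPast X i ≤ ‹MeasurableSpace Ω› :=
  iSup₂_le fun k _ => (hX k).comap_le

lemma indep_strictPast (hX : ∀ i, Measurable (X i)) (hind : iIndepFun X P) (i : ℕ) :
    Indep (strictPast X i) (MeasurableSpace.comap (X i) inferInstance) P := by
  suffices Indep (strictPast X i)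
      (⨆ k ∈ ({i} : Set ℕ), MeasurableSpace.comap (X k) inferInstance) P by
    rwa [iSup_singleton] at this
  exact indep_iSup_of_disjoint (fun k => (hX k).comap_le) hind (by simp)

lemma measurable_nth_nonzero (hX : ∀ i, Measurable (X i)) (k : ℕ) :
    Measurable fun ω => Nat.nth (fun m => X m ω ≠ 0) k := by
  -- `Nat.nth` returns the default `0` when there are too few nonzero terms, so the value `0` is
  -- ambiguous; its preimage is obtained below as the complement of all the others.
  have hpos : ∀ i, i ≠ 0 →
      MeasurableSet ((fun ω => Nat.nth (fun m => X m ω ≠ 0) k) ⁻¹' {i}) := by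
    intro i hi
    have : (fun ω => Nat.nth (fun m => X m ω ≠ 0) k) ⁻¹' {i} =
        {ω | nonzeroCount X i ω = k} ∩ {ω | X i ω ≠ 0} := by
      ext ω
      constructor
      · intro h
        have h' : Nat.nth (fun m => X m ω ≠ 0) k = i := h
        classical
        have hcard := Nat.lt_card_toFinset_of_nth_ne_zero (p := fun m => X m ω ≠ 0) (n := k)
          (h' ▸ hi)
        have h1 := Nat.nth_mem k hcard
        have h2 := Nat.count_nth hcard
        rw [h'] at h1 h2
        refine ⟨?_, h1⟩
        rw [Set.mem_ofPred_eq, nonzeroCount]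
        convert h2
      · rintro ⟨h1, h2⟩
        exact nth_nonzero_eq h1 h2
    rw [this]
    refine MeasurableSet.inter ?_ ((hX i) (measurableSet_singleton (0 : ℝ)).compl)
    exact strictPast_le hX i _ (measurable_nonzeroCount le_rfl (measurableSet_singleton k))
  refine measurable_to_countable' fun i => ?_
  rcases eq_or_ne i 0 with rfl | hi
  · have : (fun ω => Nat.nth (fun m => X m ω ≠ 0) k) ⁻¹' {0} =
        (⋃ i ∈ {i : ℕ | i ≠ 0}, (fun ω => Nat.nth (fun m => X m ω ≠ 0) k) ⁻¹' {i})ᶜ := by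
      ext ω
      simp only [Set.mem_preimage, Set.mem_singleton_iff, Set.mem_compl_iff, Set.mem_iUnion,
        Set.mem_ofPred_eq, not_exists]
      exact ⟨fun h i hi h' => hi (h' ▸ h), fun h => by_contra fun h' => h _ h' rfl⟩
    rw [this]
    exact (MeasurableSet.biUnion (Set.to_countable _) fun i hi => hpos i hi).compl
  · exact hpos i hi

lemma measurable_nonzeroObs (hX : ∀ i, Measurable (X i)) (k : ℕ) :
    Measurable (nonzeroObs X k) := by
  have h : Measurable (fun p : ℕ × Ω => X p.1 p.2) := measurable_from_prod_countable_right hX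
  exact h.comp ((measurable_nth_nonzero hX k).prodMk measurable_id)

/-- Infinitely many terms of an i.i.d. sequence are nonzero. -/
lemma ae_infinite_nonzero {μ : Measure ℝ} (hX : ∀ i, Measurable (X i)) (hind : iIndepFun X P)
    (hlaw : ∀ i, P.map (X i) = μ) (hμ : μ {0}ᶜ ≠ 0) :
    ∀ᵐ ω ∂P, {m | X m ω ≠ 0}.Infinite := by
  have := hind.isProbabilityMeasure
  have hm : ∀ i, MeasurableSet {ω | X i ω ≠ 0} := fun i =>
    hX i (measurableSet_singleton (0 : ℝ)).compl
  have hs : iIndepSet (fun i => {ω | X i ω ≠ 0}) P := by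
    rw [iIndepSet_iff_meas_biInter hm]
    intro S
    exact hind.measure_inter_preimage_eq_mul S (sets := fun _ => {0}ᶜ)
      (fun _ _ => (measurableSet_singleton _).compl)
  have h1 := measure_limsup_eq_one hm hs (by
    have : ∀ i, P {ω | X i ω ≠ 0} = μ {0}ᶜ := fun i => by
      rw [← hlaw i, Measure.map_apply (hX i) (measurableSet_singleton _).compl]
      rfl
    simp_rw [this]
    exact ENNReal.tsum_const_eq_top_of_ne_zero hμ)
  have h2 := (mem_ae_iff_prob_eq_one (MeasurableSet.measurableSet_limsup hm)).2 h1
  filter_upwards [h2] with ω hω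
  rw [mem_limsup_iff_frequently_mem] at hω
  exact Nat.frequently_atTop_iff_infinite.1 hω

/-- A stopping-time argument. The hypothesis on `H` says that, on the event that exactly `k` nonzero
terms precede index `i`, `H` is decided by the terms before `i`. Almost surely the `k`-th nonzero
term sits at a unique such `i`, and `X i` is independent of that past. -/
lemma measure_inter_nonzeroObs {μ : Measure ℝ} (hX : ∀ i, Measurable (X i))
    (hind : iIndepFun X P) (hlaw : ∀ i, P.map (X i) = μ) (hμ : μ {0}ᶜ ≠ 0) {k : ℕ} {H : Set Ω}
    (hH : ∀ i, MeasurableSet[strictPast X i] (H ∩ {ω | nonzeroCount X i ω = k}))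
    {B : Set ℝ} (hB : MeasurableSet B) :
    P (H ∩ nonzeroObs X k ⁻¹' B) = P H * μ[|{0}ᶜ] B := by
  have := hind.isProbabilityMeasure
  have hμP : IsProbabilityMeasure μ := by
    rw [← hlaw 0]; exact Measure.isProbabilityMeasure_map (hX 0).aemeasurable
  have key : ∀ B : Set ℝ, MeasurableSet B → P (H ∩ nonzeroObs X k ⁻¹' B) =
      (∑' i, P (H ∩ {ω | nonzeroCount X i ω = k})) * μ ({0}ᶜ ∩ B) := by
    intro B hB
    have hB' : MeasurableSet ({0}ᶜ ∩ B) := (measurableSet_singleton (0 : ℝ)).compl.inter hB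
    have hae : (H ∩ nonzeroObs X k ⁻¹' B : Set Ω) =ᵐ[P]
        (⋃ i, (H ∩ {ω | nonzeroCount X i ω = k}) ∩ X i ⁻¹' ({0}ᶜ ∩ B) : Set Ω) := by
      rw [eventuallyEq_set]
      filter_upwards [ae_infinite_nonzero hX hind hlaw hμ] with ω hω
      constructor
      · rintro ⟨h1, h2⟩
        obtain ⟨h3, h4⟩ := nonzeroCount_nth_of_infinite hω k
        exact Set.mem_iUnion.2 ⟨_, ⟨h1, h4⟩, h3, h2⟩
      · intro h
        obtain ⟨i, ⟨h1, h2⟩, h3, h4⟩ := Set.mem_iUnion.1 h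
        refine ⟨h1, ?_⟩
        rw [Set.mem_preimage, nonzeroObs, nth_nonzero_eq h2 h3]
        exact h4
    rw [measure_congr hae, measure_iUnion, ← ENNReal.tsum_mul_right]
    · congr 1
      ext i
      rw [(Indep_iff _ _ P).1 (indep_strictPast hX hind i) _ _ (hH i) ⟨_, hB', rfl⟩, ← hlaw i,
        Measure.map_apply (hX i) hB']
    · intro i j hij
      refine Set.disjoint_left.2 fun ω hi hj => hij ?_
      rw [← nth_nonzero_eq hi.1.2 hi.2.1, ← nth_nonzero_eq hj.1.2 hj.2.1]
    · exact fun i => (strictPast_le hX i _ (hH i)).inter (hX i hB')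
  -- Taking `B = univ` evaluates the unknown series: it equals `P H / μ {0}ᶜ`.
  have h1 := key Set.univ MeasurableSet.univ
  rw [Set.preimage_univ, Set.inter_univ, Set.inter_univ] at h1
  rw [key B hB, h1, cond_apply (measurableSet_singleton _).compl, mul_assoc,
    ← mul_assoc (μ {0}ᶜ), ENNReal.mul_inv_cancel hμ (measure_ne_top _ _), one_mul]

/-- The nonzero terms of an i.i.d. sequence with law `μ` have the law `μ` conditioned on being
nonzero. -/
lemma map_nonzeroObs {μ : Measure ℝ} (hX : ∀ i, Measurable (X i))
    (hind : iIndepFun X P) (hlaw : ∀ i, P.map (X i) = μ) (hμ : μ {0}ᶜ ≠ 0) (k : ℕ) :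
    P.map (nonzeroObs X k) = μ[|{0}ᶜ] := by
  have := hind.isProbabilityMeasure
  ext B hB
  rw [Measure.map_apply (measurable_nonzeroObs hX k) hB]
  have := measure_inter_nonzeroObs hX hind hlaw hμ (k := k) (H := Set.univ) (fun i => by
    rw [Set.univ_inter]
    exact measurable_nonzeroCount le_rfl (measurableSet_singleton k)) hB
  rwa [Set.univ_inter, measure_univ, one_mul] at this

/-- The nonzero terms of an i.i.d. sequence are pairwise independent. -/
lemma indepFun_nonzeroObs {μ : Measure ℝ} (hX : ∀ i, Measurable (X i))
    (hind : iIndepFun X P) (hlaw : ∀ i, P.map (X i) = μ) (hμ : μ {0}ᶜ ≠ 0) {j k : ℕ}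
    (hjk : j ≠ k) : IndepFun (nonzeroObs X j) (nonzeroObs X k) P := by
  wlog hlt : j < k generalizing j k
  · exact (this hjk.symm (by omega)).symm
  rw [indepFun_iff_measure_inter_preimage_eq_mul]
  intro A B hA hB
  rw [measure_inter_nonzeroObs hX hind hlaw hμ _ hB, ← map_nonzeroObs hX hind hlaw hμ k,
    Measure.map_apply (measurable_nonzeroObs hX k) hB]
  intro i
  -- If `k > j` nonzero terms precede `i`, the `j`-th one occurs at some `m < i`, so an event about
  -- it belongs to the strict past of `i`.
  have : nonzeroObs X j ⁻¹' A ∩ {ω | nonzeroCount X i ω = k} =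
      (⋃ m ∈ {m | m < i}, X m ⁻¹' ({0}ᶜ ∩ A) ∩ {ω | nonzeroCount X m ω = j}) ∩
        {ω | nonzeroCount X i ω = k} := by
    ext ω
    constructor
    · rintro ⟨h1, h2⟩
      obtain ⟨h3, h4, h5⟩ := nonzeroCount_nth_of_lt (k := j) (i := i) (ω := ω) (X := X)
        (by rw [Set.mem_ofPred_eq] at h2; omega)
      exact ⟨Set.mem_biUnion h3 ⟨⟨h4, h1⟩, h5⟩, h2⟩
    · rintro ⟨h1, h2⟩
      obtain ⟨m, h3, h4, h5⟩ := Set.mem_iUnion₂.1 h1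
      refine ⟨?_, h2⟩
      rw [Set.mem_preimage, nonzeroObs, nth_nonzero_eq h5 h4.1]
      exact h4.2
  rw [this]
  let _ := strictPast X i
  refine MeasurableSet.inter (MeasurableSet.biUnion (Set.to_countable _) fun m hm => ?_) ?_
  · refine MeasurableSet.inter ?_ ?_
    · exact measurable_strictPast hm ((measurableSet_singleton (0 : ℝ)).compl.inter hA)
    · exact measurable_nonzeroCount (le_of_lt hm) (measurableSet_singleton j)
  · exact measurable_nonzeroCount le_rfl (measurableSet_singleton k)

end NonzeroObs

/-! ### The characteristic function of the conditioned compound Poisson law -/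

section CompoundPoisson

variable {Ω : Type*} [MeasurableSpace Ω] {P : Measure Ω} {lam : ℝ} {f : ℝ → ℝ}
  {N : Ω → ℕ} {Y : ℕ → Ω → ℝ}

lemma fnCharFun_eq_charFun (hf : Measurable f) (hf0 : ∀ y, 0 ≤ f y) (t : ℝ) :
    fnCharFun f t = charFun (volume.withDensity fun y => ENNReal.ofReal (f y)) t := by
  rw [charFun_apply_real, integral_withDensity_eq_integral_toReal_smul
    (by fun_prop) (ae_of_all _ fun _ => ENNReal.ofReal_lt_top), fnCharFun]
  congr 1
  ext u
  rw [ENNReal.toReal_ofReal (hf0 u), Complex.real_smul, mul_comm]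

lemma measurable_sum_range_uncurry :
    Measurable fun p : ℕ × (ℕ → ℝ) => ∑ j ∈ Finset.range p.1, p.2 j :=
  measurable_from_prod_countable_right fun n =>
    show Measurable fun y : ℕ → ℝ => ∑ j ∈ Finset.range n, y j by fun_prop

/-- Integration against the law of a random sum by conditioning on the number of summands. -/
lemma integral_randomSum [IsProbabilityMeasure P] (hm : IsCompoundPoissonModel P lam f N Y)
    {G : ℝ → ℂ} (hG : Measurable G) {C : ℝ} (hC : ∀ x, ‖G x‖ ≤ C) :
    ∫ ω, G (randomSum N Y ω) ∂P = ∑' n : ℕ,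
      (Real.exp (-lam.toNNReal) * lam.toNNReal ^ n / n.factorial : ℝ) •
        ∫ ω, G (∑ j ∈ Finset.range n, Y j ω) ∂P := by
  have hY : AEMeasurable (fun ω j => Y j ω) P :=
    aemeasurable_pi_iff.2 fun j => (hm.law_summand j).aemeasurable
  have hN := hm.law_count.aemeasurable
  have := Measure.isProbabilityMeasure_map hY
  have hprod := (indepFun_iff_map_prod_eq_prod_map_map hN hY).1 hm.indep_count
  rw [hm.law_count.map_eq] at hprod
  have hG2 : Measurable fun p : ℕ × (ℕ → ℝ) => G (∑ j ∈ Finset.range p.1, p.2 j) :=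
    hG.comp measurable_sum_range_uncurry
  calc ∫ ω, G (randomSum N Y ω) ∂P
      = ∫ p, G (∑ j ∈ Finset.range p.1, p.2 j) ∂(P.map fun ω => (N ω, fun j => Y j ω)) := by
        rw [integral_map (hN.prodMk hY) hG2.aestronglyMeasurable]
        rfl
    _ = ∫ n, ∫ y, G (∑ j ∈ Finset.range n, y j) ∂(P.map fun ω j => Y j ω)
          ∂(poissonMeasure lam.toNNReal) := by
        rw [hprod, integral_prod]
        exact Integrable.of_bound hG2.aestronglyMeasurable C (ae_of_all _ fun _ => hC _)
    _ = _ := by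
        rw [integral_poissonMeasure]
        congr 1
        ext1 n
        rw [integral_map hY]
        exact (hG.comp (by fun_prop)).aestronglyMeasurable

lemma integral_exp_sum_range (hf : Measurable f) (hf0 : ∀ y, 0 ≤ f y)
    (hm : IsCompoundPoissonModel P lam f N Y) (n : ℕ) (t : ℝ) :
    ∫ ω, Complex.exp (t * (∑ j ∈ Finset.range n, Y j ω : ℝ) * Complex.I) ∂P =
      fnCharFun f t ^ n := by
  have hY := fun j => (hm.law_summand j).aemeasurable
  have h := (hm.indep_summands.restrict (Finset.range n)).charFun_map_fun_finsetSum_eq_prod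
    (fun i _ => hY i)
  have h1 := congrFun h t
  rw [charFun_apply_real, integral_map (Finset.aemeasurable_fun_sum _ fun i _ => hY i)
    (by fun_prop)] at h1
  rw [h1, Finset.prod_apply]
  simp_rw [(hm.law_summand _).map_eq, ← fnCharFun_eq_charFun hf hf0]
  simp

/-- Given the first `m` summands, the next one would have to hit a single point, which is null for a
law with a density. Up to null sets, the random sum thus vanishes only when `N = 0`. -/
lemma ae_sum_range_ne_zero [IsProbabilityMeasure P] (hm : IsCompoundPoissonModel P lam f N Y)
    {n : ℕ} (hn : n ≠ 0) : ∀ᵐ ω ∂P, ∑ j ∈ Finset.range n, Y j ω ≠ 0 := by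
  obtain ⟨m, rfl⟩ := Nat.exists_eq_succ_of_ne_zero hn
  have hY := fun j => (hm.law_summand j).aemeasurable
  have hS : AEMeasurable (∑ j ∈ Finset.range m, Y j) P :=
    Finset.aemeasurable_sum _ fun i _ => hY i
  have hind : IndepFun (∑ j ∈ Finset.range m, Y j) (Y m) P :=
    hm.indep_summands.indepFun_finsetSum_of_notMem₀ hY (by simp)
  have := Measure.isProbabilityMeasure_map (hY m)
  have hmap := (indepFun_iff_map_prod_eq_prod_map_map hS (hY m)).1 hind
  have hset : MeasurableSet {p : ℝ × ℝ | p.1 + p.2 = 0} :=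
    measurableSet_eq_fun (by fun_prop) (by fun_prop)
  have h0 : P.map (fun ω => ((∑ j ∈ Finset.range m, Y j) ω, Y m ω))
      {p : ℝ × ℝ | p.1 + p.2 = 0} = 0 := by
    rw [hmap, Measure.measure_prod_null hset]
    refine ae_of_all _ fun s => ?_
    have : (Prod.mk s ⁻¹' {p : ℝ × ℝ | p.1 + p.2 = 0}) = {-s} := by
      ext y
      simp [eq_neg_iff_add_eq_zero, add_comm]
    beta_reduce
    rw [this, (hm.law_summand m).map_eq, Pi.zero_apply]
    exact withDensity_absolutelyContinuous _ _ (measure_singleton _)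
  rw [Measure.map_apply_of_aemeasurable (hS.prodMk (hY m)) hset] at h0
  rw [ae_iff]
  convert h0 using 2
  ext ω
  simp [Finset.sum_range_succ]

lemma hasSum_exp_smul (r : ℝ) (z : ℂ) :
    HasSum (fun n : ℕ => (Real.exp (-r) * r ^ n / n.factorial : ℝ) • z ^ n)
      (Complex.exp (-r) * Complex.exp (r * z)) := by
  have h := NormedSpace.expSeries_div_hasSum_exp (r * z : ℂ)
  rw [← Complex.exp_eq_exp_ℂ] at h
  have h2 := h.mul_left (Complex.exp (-r))
  refine h2.congr_fun fun n => ?_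
  rw [Complex.real_smul, mul_pow]
  push_cast
  ring

lemma setIntegral_exp_randomSum [IsProbabilityMeasure P] (hlam : 0 < lam) (hf : Measurable f)
    (hf0 : ∀ y, 0 ≤ f y) (hm : IsCompoundPoissonModel P lam f N Y)
    (hS : AEMeasurable (randomSum N Y) P) (t : ℝ) :
    ∫ x in {0}ᶜ, Complex.exp (t * x * Complex.I) ∂(P.map (randomSum N Y)) =
      Complex.exp (-lam) * (Complex.exp (lam * fnCharFun f t) - 1) := by
  have hms : MeasurableSet ({0}ᶜ : Set ℝ) := (measurableSet_singleton _).compl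
  set G : ℝ → ℂ := ({0}ᶜ : Set ℝ).indicator fun x => Complex.exp (t * x * Complex.I) with hGdef
  have hG : Measurable G := Measurable.indicator (by fun_prop) hms
  have hC : ∀ x, ‖G x‖ ≤ 1 := fun x => by
    refine (norm_indicator_le_norm_self _ _).trans ?_
    rw [← Complex.ofReal_mul, Complex.norm_exp_ofReal_mul_I]
  have hcoe : ((lam.toNNReal : NNReal) : ℝ) = lam := Real.coe_toNNReal _ hlam.le
  have h1 := integral_randomSum hm hG hC
  rw [hcoe] at h1
  rw [← integral_indicator hms, integral_map hS hG.aestronglyMeasurable, h1]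
  have hterm : ∀ n : ℕ, n ≠ 0 → ∫ ω, G (∑ j ∈ Finset.range n, Y j ω) ∂P = fnCharFun f t ^ n := by
    intro n hn
    rw [← integral_exp_sum_range hf hf0 hm]
    refine integral_congr_ae ?_
    filter_upwards [ae_sum_range_ne_zero hm hn] with ω hω
    rw [hGdef, Set.indicator_of_mem (by simpa using hω)]
  -- The restriction to nonzero values removes exactly the `n = 0` term `e^{-λ}` of the exponential
  -- series.
  have hs := hasSum_exp_smul lam (fnCharFun f t)
  have hs2 := hs.sub (hasSum_ite_eq (0 : ℕ) (Complex.exp (-lam)))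
  rw [mul_sub, mul_one, ← hs2.tsum_eq]
  congr 1
  ext1 n
  rcases eq_or_ne n 0 with rfl | hn
  · simp [hGdef]
  · rw [hterm n hn, if_neg hn, sub_zero]

/-- The characteristic function of a compound Poisson variable conditioned on being nonzero. -/
lemma charFun_cond_randomSum [IsProbabilityMeasure P] (hlam : 0 < lam) (hf : Measurable f)
    (hf0 : ∀ y, 0 ≤ f y) (hm : IsCompoundPoissonModel P lam f N Y)
    (hS : AEMeasurable (randomSum N Y) P) :
    (P.map (randomSum N Y)) {0}ᶜ ≠ 0 ∧ ∀ t, ((Real.exp lam - 1 : ℝ) : ℂ) *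
      charFun ((P.map (randomSum N Y))[|{0}ᶜ]) t + 1 = Complex.exp (lam * fnCharFun f t) := by
  set μ := P.map (randomSum N Y) with hμ
  have hμP : IsProbabilityMeasure μ := Measure.isProbabilityMeasure_map hS
  have hφ0 : fnCharFun f 0 = 1 := by
    rw [fnCharFun_eq_charFun hf hf0, charFun_zero, ← (hm.law_summand 0).map_eq]
    have := Measure.isProbabilityMeasure_map (hm.law_summand 0).aemeasurable
    simp
  have hE : 0 < Real.exp lam - 1 := by linarith [Real.add_one_lt_exp hlam.ne']
  have hmass : μ.real {0}ᶜ = Real.exp (-lam) * (Real.exp lam - 1) := by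
    -- At `t = 0` the identity gives the probability of a nonzero sum, the normalising constant of
    -- the conditioning.
    have := setIntegral_exp_randomSum hlam hf hf0 hm hS 0
    rw [← hμ, hφ0] at this
    simp only [Complex.ofReal_zero, zero_mul, Complex.exp_zero, integral_const, mul_one,
      measureReal_restrict_apply_univ, Complex.real_smul] at this
    exact_mod_cast this
  have hne : μ {0}ᶜ ≠ 0 := fun h => by
    rw [measureReal_def, h, ENNReal.toReal_zero] at hmass
    exact (mul_pos (Real.exp_pos _) hE).ne hmass
  refine ⟨hne, fun t => ?_⟩
  rw [charFun_apply_real, ProbabilityTheory.cond, integral_smul_measure, setIntegral_exp_randomSum hlam hf hf0 hm hS,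
    ENNReal.toReal_inv, ← measureReal_def, hmass, Complex.real_smul]
  have h1 : ((Real.exp lam - 1 : ℝ) : ℂ) ≠ 0 := by exact_mod_cast hE.ne'
  have h2 : Complex.exp (-lam) ≠ 0 := Complex.exp_ne_zero _
  have h3 : ((Real.exp (-lam) * (Real.exp lam - 1))⁻¹ : ℝ) =
      (Complex.exp (-lam) * ((Real.exp lam - 1 : ℝ) : ℂ))⁻¹ := by push_cast; rfl
  rw [h3]
  field_simp
  ring

end CompoundPoisson

/-! ### Second moments of the empirical characteristic function -/

section Sampling

variable {Ω : Type*} [MeasurableSpace Ω] {P : Measure Ω} [IsProbabilityMeasure P]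
  {Z : ℕ → Ω → ℝ} {q : Measure ℝ}

/-- `Z` is a sequence of pairwise independent variables with the common law `q`. -/
structure IsPairwiseIIDSample (P : Measure Ω) (Z : ℕ → Ω → ℝ) (q : Measure ℝ) : Prop where
  measurable : ∀ j, Measurable (Z j)
  map_eq : ∀ j, P.map (Z j) = q
  indep : ∀ j k, j ≠ k → IndepFun (Z j) (Z k) P


/-- The left side is a variance, for which pairwise independence is enough; each single variance is
at most the second moment. -/
lemma integral_sq_empirical_sub_le (hZ : IsPairwiseIIDSample P Z q) {F : ℝ → ℝ}
    (hF : Measurable F) {C : ℝ} (hC : ∀ x, |F x| ≤ C) {n : ℕ} (hn : n ≠ 0) :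
    ∫ ω, ((1 / (n : ℝ)) * ∑ j ∈ Finset.range n, F (Z j ω) - ∫ x, F x ∂q) ^ 2 ∂P ≤
      (1 / (n : ℝ)) * ∫ x, F x ^ 2 ∂q := by
  have hn' : (n : ℝ) ≠ 0 := by exact_mod_cast hn
  have hL : ∀ j, MemLp (fun ω => F (Z j ω)) 2 P := fun j =>
    MemLp.of_bound (hF.comp (hZ.measurable j)).aestronglyMeasurable C (ae_of_all _ fun _ => hC _)
  have hint : ∀ j, ∫ ω, F (Z j ω) ∂P = ∫ x, F x ∂q := fun j => by
    rw [← hZ.map_eq j, integral_map (hZ.measurable j).aemeasurable hF.aestronglyMeasurable]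
  have hint2 : ∀ j, ∫ ω, F (Z j ω) ^ 2 ∂P = ∫ x, F x ^ 2 ∂q := fun j => by
    rw [← hZ.map_eq j, integral_map (hZ.measurable j).aemeasurable
      (hF.pow_const 2).aestronglyMeasurable]
  have hmean : ∫ ω, (1 / (n : ℝ)) * ∑ j ∈ Finset.range n, F (Z j ω) ∂P = ∫ x, F x ∂q := by
    rw [integral_const_mul, integral_finsetSum _ fun j _ => (hL j).integrable (by norm_num)]
    simp_rw [hint]
    rw [Finset.sum_const, Finset.card_range, nsmul_eq_mul]
    field_simp
  have hmeas : AEMeasurable (fun ω => (1 / (n : ℝ)) * ∑ j ∈ Finset.range n, F (Z j ω)) P :=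
    ((Finset.measurable_fun_sum _ fun j _ => hF.comp (hZ.measurable j)).const_mul _).aemeasurable
  have hvar := variance_eq_integral hmeas
  rw [hmean] at hvar
  rw [← hvar, variance_const_mul]
  have hsum : Var[fun ω => ∑ j ∈ Finset.range n, F (Z j ω); P] =
      ∑ j ∈ Finset.range n, Var[fun ω => F (Z j ω); P] := by
    rw [← IndepFun.variance_sum (fun j _ => hL j)
      (fun j _ k _ hjk => (hZ.indep j k hjk).comp hF hF)]
    congr 1
    ext ω
    simp
  have hle : ∀ j ∈ Finset.range n, Var[fun ω => F (Z j ω); P] ≤ ∫ x, F x ^ 2 ∂q := fun j _ => by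
    rw [← hint2 j]
    exact variance_le_expectation_sq (hL j).aestronglyMeasurable
  rw [hsum]
  calc (1 / (n : ℝ)) ^ 2 * ∑ j ∈ Finset.range n, Var[fun ω => F (Z j ω); P]
      ≤ (1 / (n : ℝ)) ^ 2 * ∑ j ∈ Finset.range n, ∫ x, F x ^ 2 ∂q := by
        gcongr with j hj
        exact hle j hj
    _ = _ := by
        rw [Finset.sum_const, Finset.card_range, nsmul_eq_mul]
        field_simp

variable [IsProbabilityMeasure q]

lemma integral_norm_sq_empirical_sub_le (hZ : IsPairwiseIIDSample P Z q) {F : ℝ → ℂ}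
    (hF : Measurable F) {C : ℝ} (hC : ∀ x, ‖F x‖ ≤ C) {n : ℕ} (hn : n ≠ 0) :
    ∫ ω, ‖(1 / (n : ℂ)) * ∑ j ∈ Finset.range n, F (Z j ω) - ∫ x, F x ∂q‖ ^ 2 ∂P ≤
      (1 / (n : ℝ)) * ∫ x, ‖F x‖ ^ 2 ∂q := by
  have hFi : Integrable F q := Integrable.of_bound hF.aestronglyMeasurable C (ae_of_all _ hC)
  have hre : Measurable fun x => (F x).re := Complex.measurable_re.comp hF
  have him : Measurable fun x => (F x).im := Complex.measurable_im.comp hF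
  have hreC : ∀ x, |(F x).re| ≤ C := fun x => (Complex.abs_re_le_norm _).trans (hC x)
  have himC : ∀ x, |(F x).im| ≤ C := fun x => (Complex.abs_im_le_norm _).trans (hC x)
  have hint : ∀ G : ℝ → ℝ, Measurable G → (∀ x, |G x| ≤ C) → Integrable (fun ω =>
      ((1 / (n : ℝ)) * ∑ j ∈ Finset.range n, G (Z j ω) - ∫ x, G x ∂q) ^ 2) P := by
    intro G hG hGC
    have h1 : MemLp (fun ω => ∑ j ∈ Finset.range n, G (Z j ω)) 2 P :=
      memLp_finsetSum _ fun j _ => MemLp.of_bound (hG.comp (hZ.measurable j)).aestronglyMeasurable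
        C (ae_of_all _ fun _ => hGC _)
    have h2 : MemLp (fun ω => (1 / (n : ℝ)) * ∑ j ∈ Finset.range n, G (Z j ω)) 2 P :=
      h1.const_mul _
    exact (h2.sub (memLp_const (∫ x, G x ∂q))).integrable_sq
  have hq : ∀ G : ℝ → ℝ, Measurable G → (∀ x, |G x| ≤ C) → Integrable (fun x => G x ^ 2) q := by
    intro G hG hGC
    exact (MemLp.of_bound hG.aestronglyMeasurable C (ae_of_all _ hGC) : MemLp G 2 q).integrable_sq
  have hsq : ∀ z : ℂ, ‖z‖ ^ 2 = z.re ^ 2 + z.im ^ 2 := fun z => by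
    rw [← Complex.normSq_eq_norm_sq, Complex.normSq_apply]; ring
  have hn2 : (1 / (n : ℂ)) = ((1 / (n : ℝ) : ℝ) : ℂ) := by push_cast; rfl
  have hpt : ∀ ω, ‖(1 / (n : ℂ)) * ∑ j ∈ Finset.range n, F (Z j ω) - ∫ x, F x ∂q‖ ^ 2 =
      ((1 / (n : ℝ)) * ∑ j ∈ Finset.range n, (F (Z j ω)).re - ∫ x, (F x).re ∂q) ^ 2 +
      ((1 / (n : ℝ)) * ∑ j ∈ Finset.range n, (F (Z j ω)).im - ∫ x, (F x).im ∂q) ^ 2 := by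
    intro ω
    have h1 : (∫ x, F x ∂q).re = ∫ x, (F x).re ∂q := (integral_re hFi).symm
    have h2 : (∫ x, F x ∂q).im = ∫ x, (F x).im ∂q := (integral_im hFi).symm
    rw [hsq, hn2, Complex.sub_re, Complex.sub_im, Complex.re_ofReal_mul, Complex.im_ofReal_mul,
      Complex.re_sum, Complex.im_sum, h1, h2]
  simp_rw [hpt]
  rw [integral_add (hint _ hre hreC) (hint _ him himC)]
  simp_rw [hsq]
  rw [integral_add (hq _ hre hreC) (hq _ him himC), mul_add]
  exact add_le_add (integral_sq_empirical_sub_le hZ hre hreC hn)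
    (integral_sq_empirical_sub_le hZ him himC hn)

/-- The deviation of the empirical characteristic function from the characteristic function. -/
noncomputable def empDeviation (q : Measure ℝ) (n : ℕ) (z : ℕ → ℝ) (t : ℝ) : ℂ :=
  empCharFun n z t - charFun q t

lemma norm_exp_mul_I (t z : ℝ) : ‖Complex.exp (t * z * Complex.I)‖ = 1 := by
  rw [← Complex.ofReal_mul, Complex.norm_exp_ofReal_mul_I]

lemma norm_empCharFun_le (n : ℕ) (z : ℕ → ℝ) (t : ℝ) : ‖empCharFun n z t‖ ≤ 1 := by
  rw [empCharFun, norm_mul]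
  have h1 : ‖∑ j ∈ Finset.range n, Complex.exp (t * z j * Complex.I)‖ ≤ n := by
    refine (norm_sum_le _ _).trans ?_
    simp [norm_exp_mul_I]
  rw [norm_div, norm_one, Complex.norm_natCast, one_div]
  exact inv_mul_le_one_of_le₀ h1 (Nat.cast_nonneg n)

lemma continuous_empCharFun (n : ℕ) (z : ℕ → ℝ) : Continuous (empCharFun n z) := by
  unfold empCharFun
  fun_prop

lemma continuous_empDeviation (n : ℕ) (z : ℕ → ℝ) : Continuous (empDeviation q n z) :=
  (continuous_empCharFun n z).sub continuous_charFun

lemma norm_empDeviation_le (n : ℕ) (z : ℕ → ℝ) (t : ℝ) : ‖empDeviation q n z t‖ ≤ 2 := by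
  refine (norm_sub_le _ _).trans ?_
  linarith [norm_empCharFun_le n z t, norm_charFun_le_one (μ := q) t]

lemma measurable_empDeviation_uncurry (hZ : ∀ j, Measurable (Z j)) (n : ℕ) :
    Measurable fun p : Ω × ℝ => empDeviation q n (fun k => Z k p.1) p.2 := by
  have hc : Measurable (charFun q) := continuous_charFun.measurable
  unfold empDeviation empCharFun
  fun_prop

lemma integral_norm_sq_empDeviation_le (hZ : IsPairwiseIIDSample P Z q) {n : ℕ} (hn : n ≠ 0)
    (t : ℝ) : ∫ ω, ‖empDeviation q n (fun k => Z k ω) t‖ ^ 2 ∂P ≤ 1 / n := by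
  have := integral_norm_sq_empirical_sub_le hZ (F := fun z => Complex.exp (t * z * Complex.I))
    (by fun_prop) (fun z => (norm_exp_mul_I t z).le) hn
  simp only [norm_exp_mul_I, one_pow, integral_const, probReal_univ, smul_eq_mul, mul_one] at this
  simpa only [empDeviation, empCharFun, charFun_apply_real] using this

/-- The mean integrated squared deviation over a finite measure. -/
lemma integral_integral_norm_sq_empDeviation_le (hZ : IsPairwiseIIDSample P Z q) {n : ℕ}
    (hn : n ≠ 0) (ρ : Measure ℝ) [IsFiniteMeasure ρ] :
    ∫ ω, ∫ t, ‖empDeviation q n (fun k => Z k ω) t‖ ^ 2 ∂ρ ∂P ≤ ρ.real Set.univ / n := by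
  have hm : AEStronglyMeasurable (fun p : Ω × ℝ => ‖empDeviation q n (fun k => Z k p.1) p.2‖ ^ 2)
      (P.prod ρ) :=
    ((measurable_empDeviation_uncurry hZ.measurable n).norm.pow_const 2).aestronglyMeasurable
  have hi : Integrable (fun p : Ω × ℝ => ‖empDeviation q n (fun k => Z k p.1) p.2‖ ^ 2)
      (P.prod ρ) := by
    refine Integrable.of_bound hm (2 ^ 2) (ae_of_all _ fun p => ?_)
    rw [norm_pow, norm_norm]
    gcongr
    exact norm_empDeviation_le _ _ _
  rw [integral_integral_swap hi]
  calc ∫ t, ∫ ω, ‖empDeviation q n (fun k => Z k ω) t‖ ^ 2 ∂P ∂ρ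
      ≤ ∫ t, (1 / n : ℝ) ∂ρ := by
        refine integral_mono hi.integral_prod_right (integrable_const _) fun t => ?_
        exact integral_norm_sq_empDeviation_le hZ hn t
    _ = _ := by
        rw [integral_const, smul_eq_mul]
        ring

/-- The transform `z ↦ ∫ a(t) exp(i t z) dρ(t)`. -/
noncomputable def weightedExp (ρ : Measure ℝ) (a : ℝ → ℂ) (z : ℝ) : ℂ :=
  ∫ t, a t * Complex.exp (t * z * Complex.I) ∂ρ

lemma norm_weightedExp_le {ρ : Measure ℝ} [IsFiniteMeasure ρ] {a : ℝ → ℂ} {A : ℝ}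
    (hA : ∀ t, ‖a t‖ ≤ A) (z : ℝ) : ‖weightedExp ρ a z‖ ≤ A * ρ.real Set.univ := by
  refine norm_integral_le_of_norm_le_const (ae_of_all _ fun t => ?_)
  rw [norm_mul, norm_exp_mul_I, mul_one]
  exact hA t

lemma measurable_weightedExp {ρ : Measure ℝ} [IsFiniteMeasure ρ] {a : ℝ → ℂ}
    (ha : Measurable a) : Measurable (weightedExp ρ a) := by
  have : StronglyMeasurable fun p : ℝ × ℝ => a p.2 * Complex.exp (p.2 * p.1 * Complex.I) :=
    Measurable.stronglyMeasurable (by fun_prop)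
  exact this.integral_prod_right.measurable

lemma integral_weightedExp {ρ : Measure ℝ} [IsFiniteMeasure ρ] {a : ℝ → ℂ}
    (ha : Measurable a) {A : ℝ} (hA : ∀ t, ‖a t‖ ≤ A) :
    ∫ z, weightedExp ρ a z ∂q = ∫ t, a t * charFun q t ∂ρ := by
  unfold weightedExp
  rw [integral_integral_swap]
  · simp_rw [integral_const_mul, charFun_apply_real]
  · refine Integrable.of_bound (Measurable.aestronglyMeasurable (by fun_prop)) A
      (ae_of_all _ fun p => ?_)
    simp only [Function.uncurry]
    rw [norm_mul, norm_exp_mul_I, mul_one]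
    exact hA _

/-- By Fubini a linear functional of the deviation is itself an empirical mean minus its
expectation, so the variance bound applies to it. -/
lemma integral_mul_empDeviation {ρ : Measure ℝ} [IsFiniteMeasure ρ] {a : ℝ → ℂ}
    (ha : Measurable a) {A : ℝ} (hA : ∀ t, ‖a t‖ ≤ A) (n : ℕ) (z : ℕ → ℝ) :
    ∫ t, a t * empDeviation q n z t ∂ρ =
      (1 / (n : ℂ)) * ∑ j ∈ Finset.range n, weightedExp ρ a (z j) -
        ∫ x, weightedExp ρ a x ∂q := by
  have hbd : ∀ g : ℝ → ℂ, Measurable g → (∀ t, ‖g t‖ ≤ 1) → Integrable (fun t => a t * g t) ρ := by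
    intro g hg hg1
    refine Integrable.of_bound (ha.mul hg).aestronglyMeasurable A (ae_of_all _ fun t => ?_)
    rw [norm_mul]
    exact (mul_le_of_le_one_right (norm_nonneg _) (hg1 t)).trans (hA t)
  have hc : Measurable (charFun q) := continuous_charFun.measurable
  rw [integral_weightedExp ha hA]
  simp_rw [empDeviation, mul_sub]
  rw [integral_sub (hbd _ (continuous_empCharFun n z).measurable (norm_empCharFun_le n z))
    (hbd _ hc norm_charFun_le_one)]
  congr 1
  unfold weightedExp
  rw [← integral_finsetSum, ← integral_const_mul]
  · congr 1
    ext t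
    rw [empCharFun, Finset.mul_sum, Finset.mul_sum, Finset.mul_sum]
    exact Finset.sum_congr rfl fun _ _ => by ring
  · intro j _
    exact hbd _ (by fun_prop) fun t => (norm_exp_mul_I t _).le

/-- Expanding the square gives `∫∫ a(t) conj(a(u)) φ_q(t - u) du dt`. The inner integral is at most
`A ‖φ_q‖₁` for every `t`, so the bound is linear in the length of `s`; the trivial bound `|F| ≤ A
|s|` would give a quadratic one. -/
lemma integral_norm_sq_weightedExp_le {s : Set ℝ} (hs : volume s ≠ ⊤)
    {a : ℝ → ℂ} (ha : Measurable a) {A : ℝ} (hA : ∀ t, ‖a t‖ ≤ A)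
    (hq : Integrable (charFun q)) :
    ∫ x, ‖weightedExp (volume.restrict s) a x‖ ^ 2 ∂q ≤
      volume.real s * (A ^ 2 * ∫ t, ‖charFun q t‖) := by
  set ρ := volume.restrict s with hρ
  have hfin : IsFiniteMeasure ρ := ⟨by rw [hρ, Measure.restrict_apply_univ]; exact hs.lt_top⟩
  have hA0 : 0 ≤ A := (norm_nonneg _).trans (hA 0)
  set F := weightedExp ρ a with hF
  have hFm : Measurable F := measurable_weightedExp ha
  have hconjF : ∀ z, starRingEnd ℂ (F z) =
      ∫ t, starRingEnd ℂ (a t) * Complex.exp (-(t * z * Complex.I)) ∂ρ := by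
    intro z
    rw [hF, weightedExp, ← integral_conj]
    congr 1
    ext t
    rw [map_mul, ← Complex.exp_conj]
    congr 2
    simp
  have ham : Measurable fun t => starRingEnd ℂ (a t) := Complex.continuous_conj.measurable.comp ha
  have hFcm : Measurable fun z => starRingEnd ℂ (F z) :=
    Complex.continuous_conj.measurable.comp hFm
  have hinner : ∀ t : ℝ, ∫ z, Complex.exp (t * z * Complex.I) * starRingEnd ℂ (F z) ∂q =
      ∫ u, starRingEnd ℂ (a u) * charFun q (t - u) ∂ρ := by
    intro t
    simp_rw [hconjF, ← integral_const_mul]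
    rw [integral_integral_swap]
    · congr 1
      ext u
      rw [charFun_apply_real, ← integral_const_mul]
      congr 1
      ext z
      rw [mul_left_comm, ← Complex.exp_add]
      congr 2
      push_cast
      ring
    · refine Integrable.of_bound (Measurable.aestronglyMeasurable (by fun_prop)) A
        (ae_of_all _ fun p => ?_)
      simp only [Function.uncurry]
      rw [norm_mul, norm_exp_mul_I, one_mul, norm_mul, RCLike.norm_conj, ← neg_mul, ← neg_mul,
        ← Complex.ofReal_neg, norm_exp_mul_I, mul_one]
      exact hA _
  have h1 : ((∫ z, ‖F z‖ ^ 2 ∂q : ℝ) : ℂ) =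
      ∫ t, a t * ∫ u, starRingEnd ℂ (a u) * charFun q (t - u) ∂ρ ∂ρ := by
    simp_rw [← hinner, ← integral_const_mul]
    rw [← integral_integral_swap, ← integral_complex_ofReal]
    · congr 1
      ext z
      rw [Complex.ofReal_pow, ← Complex.mul_conj']
      nth_rw 1 [hF]
      rw [weightedExp, ← integral_mul_const]
      congr 1
      ext t
      ring
    · refine Integrable.of_bound (Measurable.aestronglyMeasurable ?_) (A * (A * ρ.real Set.univ))
        (ae_of_all _ fun p => ?_)
      · simp only [Function.uncurry_def]
        fun_prop
      simp only [Function.uncurry]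
      rw [norm_mul, norm_mul, norm_exp_mul_I, one_mul, RCLike.norm_conj]
      gcongr
      · exact hA _
      · exact norm_weightedExp_le hA _
  have h2 : ∫ z, ‖F z‖ ^ 2 ∂q =
      ‖∫ t, a t * ∫ u, starRingEnd ℂ (a u) * charFun q (t - u) ∂ρ ∂ρ‖ := by
    rw [← h1, Complex.norm_real, Real.norm_of_nonneg]
    exact integral_nonneg fun _ => by positivity
  rw [h2]
  have h3 := norm_integral_le_of_norm_le_const (μ := ρ) (C := A ^ 2 * ∫ t, ‖charFun q t‖)
    (f := fun t => a t * ∫ u, starRingEnd ℂ (a u) * charFun q (t - u) ∂ρ)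
    (ae_of_all _ fun t => ?_)
  · refine h3.trans_eq ?_
    rw [hρ, measureReal_restrict_apply_univ, mul_comm]
  · rw [norm_mul, pow_two, mul_assoc]
    have hsub : Integrable (fun u => ‖charFun q (t - u)‖) := (hq.comp_sub_left t).norm
    have h4 : ‖∫ u, starRingEnd ℂ (a u) * charFun q (t - u) ∂ρ‖ ≤ A * ∫ t, ‖charFun q t‖ := by
      calc ‖∫ u, starRingEnd ℂ (a u) * charFun q (t - u) ∂ρ‖
          ≤ ∫ u, A * ‖charFun q (t - u)‖ ∂ρ := by
            refine norm_integral_le_of_norm_le (hsub.restrict.const_mul A) (ae_of_all _ fun u => ?_)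
            rw [norm_mul, RCLike.norm_conj]
            gcongr
            exact hA u
        _ = A * ∫ u, ‖charFun q (t - u)‖ ∂ρ := integral_const_mul _ _
        _ ≤ A * ∫ u, ‖charFun q (t - u)‖ := by
            exact mul_le_mul_of_nonneg_left
              (setIntegral_le_integral hsub (ae_of_all _ fun _ => norm_nonneg _)) hA0
        _ = _ := by
            rw [integral_sub_left_eq_self (fun u => ‖charFun q u‖) volume t]
    gcongr
    exact hA t

end Sampling

/-! ### Convergence in probability of the deviation, integrated and uniform -/

section SamplingConvergence

variable {Ω : Type*} [MeasurableSpace Ω] {P : Measure Ω}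
  {Z : ℕ → Ω → ℝ} {q : Measure ℝ}

lemma tendsto_measureReal_of_integral_le {V : ℕ → Ω → ℝ} {b : ℕ → ℝ} (h0 : ∀ n ω, 0 ≤ V n ω)
    (hi : ∀ n, Integrable (V n) P) (hb : ∀ᶠ n in atTop, ∫ ω, V n ω ∂P ≤ b n)
    (hb0 : Tendsto b atTop (𝓝 0)) {δ : ℝ} (hδ : 0 < δ) :
    Tendsto (fun n => P.real {ω | δ ≤ V n ω}) atTop (𝓝 0) := by
  have hlim : Tendsto (fun n => b n / δ) atTop (𝓝 0) := by simpa using hb0.div_const δ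
  refine tendsto_of_tendsto_of_tendsto_of_le_of_le' tendsto_const_nhds hlim
    (Eventually.of_forall fun _ => measureReal_nonneg) ?_
  filter_upwards [hb] with n hn
  rw [le_div_iff₀' hδ]
  exact (mul_meas_ge_le_integral_of_nonneg (ae_of_all _ (h0 n)) (hi n) δ).trans hn

variable [IsProbabilityMeasure P] [IsProbabilityMeasure q]

lemma tendsto_measureReal_integral_norm_sq_empDeviation (hZ : IsPairwiseIIDSample P Z q)
    {R : ℕ → ℝ} (hR0 : ∀ᶠ n in atTop, 0 ≤ R n)
    (hR : Tendsto (fun n : ℕ => R n / n) atTop (𝓝 0)) {δ : ℝ} (hδ : 0 < δ) :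
    Tendsto (fun n : ℕ => P.real {ω | δ ≤ ∫ t in Set.Ioc (-R n) (R n),
      ‖empDeviation q n (fun k => Z k ω) t‖ ^ 2}) atTop (𝓝 0) := by
  refine tendsto_measureReal_of_integral_le (b := fun n => 2 * (R n / n))
    (fun n ω => integral_nonneg fun _ => by positivity) (fun n => ?_) ?_ ?_ hδ
  · have hm := (((measurable_empDeviation_uncurry (q := q) hZ.measurable n).norm.pow_const
      2).stronglyMeasurable.integral_prod_right' (ν := volume.restrict (Set.Ioc (-R n) (R n))))
    refine Integrable.of_bound hm.aestronglyMeasurable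
      (2 ^ 2 * (volume.restrict (Set.Ioc (-R n) (R n))).real Set.univ) (ae_of_all _ fun ω => ?_)
    refine norm_integral_le_of_norm_le_const (ae_of_all _ fun t => ?_)
    rw [norm_pow, norm_norm]
    gcongr
    exact norm_empDeviation_le _ _ _
  · filter_upwards [hR0, eventually_ne_atTop 0] with n hn hn0
    refine (integral_integral_norm_sq_empDeviation_le hZ hn0 _).trans_eq ?_
    rw [measureReal_restrict_apply_univ, Real.volume_real_Ioc_of_le (by linarith)]
    ring
  · simpa using hR.const_mul 2

lemma tendsto_measureReal_norm_integral_mul_empDeviation (hZ : IsPairwiseIIDSample P Z q)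
    (hq : Integrable (charFun q)) {R : ℕ → ℝ} (hR0 : ∀ᶠ n in atTop, 0 ≤ R n)
    (hR : Tendsto (fun n : ℕ => R n / n) atTop (𝓝 0)) {a : ℕ → ℝ → ℂ}
    (ha : ∀ n, Measurable (a n)) {A : ℝ} (hA : ∀ n t, ‖a n t‖ ≤ A) {δ : ℝ} (hδ : 0 < δ) :
    Tendsto (fun n : ℕ => P.real {ω | δ ≤ ‖∫ t in Set.Ioc (-R n) (R n),
      a n t * empDeviation q n (fun k => Z k ω) t‖}) atTop (𝓝 0) := by
  -- Passing to squares turns Markov's inequality into Chebyshev's.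
  have hset : ∀ n, {ω | δ ≤ ‖∫ t in Set.Ioc (-R n) (R n),
      a n t * empDeviation q n (fun k => Z k ω) t‖} = {ω | δ ^ 2 ≤
      ‖∫ t in Set.Ioc (-R n) (R n), a n t * empDeviation q n (fun k => Z k ω) t‖ ^ 2} := by
    intro n
    ext ω
    exact (pow_le_pow_iff_left₀ hδ.le (norm_nonneg _) two_ne_zero).symm
  simp_rw [hset]
  have hF := fun n => norm_weightedExp_le (ρ := volume.restrict (Set.Ioc (-R n) (R n))) (hA n)
  have hFm := fun n => measurable_weightedExp (ρ := volume.restrict (Set.Ioc (-R n) (R n))) (ha n)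
  simp_rw [fun (n : ℕ) (ω : Ω) => integral_mul_empDeviation (q := q)
    (ρ := volume.restrict (Set.Ioc (-R n) (R n))) (ha n) (hA n) n (fun k => Z k ω)]
  refine tendsto_measureReal_of_integral_le
    (b := fun n => 2 * (R n / n) * (A ^ 2 * ∫ t, ‖charFun q t‖))
    (fun n ω => by positivity) (fun n => ?_) ?_ ?_ (by positivity)
  · set B := A * (volume.restrict (Set.Ioc (-R n) (R n))).real Set.univ
    have hm : Measurable fun ω => ‖1 / (n : ℂ) * ∑ j ∈ Finset.range n,
        weightedExp (volume.restrict (Set.Ioc (-R n) (R n))) (a n) (Z j ω) -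
          ∫ x, weightedExp (volume.restrict (Set.Ioc (-R n) (R n))) (a n) x ∂q‖ ^ 2 :=
      ((((Finset.measurable_fun_sum _ fun j _ => (hFm n).comp (hZ.measurable j)).const_mul
        _).sub_const _).norm).pow_const 2
    refine Integrable.of_bound hm.aestronglyMeasurable
      ((‖1 / (n : ℂ)‖ * (n * B) +
        ‖∫ x, weightedExp (volume.restrict (Set.Ioc (-R n) (R n))) (a n) x ∂q‖) ^ 2)
      (ae_of_all _ fun ω => ?_)
    rw [norm_pow, norm_norm]
    gcongr
    refine (norm_sub_le _ _).trans ?_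
    rw [norm_mul]
    gcongr
    refine (norm_sum_le_of_le _ fun j _ => hF n (Z j ω)).trans_eq ?_
    rw [Finset.sum_const, Finset.card_range, nsmul_eq_mul]
  · filter_upwards [hR0, eventually_ne_atTop 0] with n hn hn0
    refine (integral_norm_sq_empirical_sub_le hZ (hFm n) (hF n) hn0).trans ?_
    have h1 := integral_norm_sq_weightedExp_le (s := Set.Ioc (-R n) (R n)) (by simp) (ha n) (hA n)
      hq
    rw [Real.volume_real_Ioc_of_le (by linarith)] at h1
    calc 1 / (n : ℝ) * ∫ x, ‖weightedExp (volume.restrict (Set.Ioc (-R n) (R n))) (a n) x‖ ^ 2 ∂q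
        ≤ 1 / (n : ℝ) * ((R n - -R n) * (A ^ 2 * ∫ t, ‖charFun q t‖)) := by gcongr
      _ = _ := by ring
  · simpa using (hR.const_mul 2).mul_const (A ^ 2 * ∫ t, ‖charFun q t‖)

/-- A substitute for a moment condition: the exponential is `K`-Lipschitz in `t` when `|z| ≤ K`, and
other `z` cost at most `2`. Averaged over `z`, the latter cost becomes a tail probability. -/
lemma norm_exp_sub_exp_le {K : ℝ} (hK : 0 ≤ K) (s t z : ℝ) :
    ‖Complex.exp (t * z * Complex.I) - Complex.exp (s * z * Complex.I)‖ ≤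
      K * |t - s| + 2 * ({z | K < |z|} : Set ℝ).indicator (fun _ => (1 : ℝ)) z := by
  by_cases hz : K < |z|
  · rw [Set.indicator_of_mem (s := {z | K < |z|}) hz]
    refine (norm_sub_le _ _).trans ?_
    rw [norm_exp_mul_I, norm_exp_mul_I]
    nlinarith [mul_nonneg hK (abs_nonneg (t - s))]
  · rw [Set.indicator_of_notMem (s := {z | K < |z|}) hz, mul_zero, add_zero]
    have h1 : Complex.exp (t * z * Complex.I) - Complex.exp (s * z * Complex.I) =
        Complex.exp (s * z * Complex.I) *
          (Complex.exp (Complex.I * (((t - s) * z : ℝ) : ℂ)) - 1) := by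
      rw [mul_sub, mul_one, ← Complex.exp_add]
      congr 2
      push_cast
      ring
    rw [h1, norm_mul, norm_exp_mul_I, one_mul]
    refine Real.norm_exp_I_mul_ofReal_sub_one_le.trans ?_
    rw [Real.norm_eq_abs, abs_mul, mul_comm]
    exact mul_le_mul_of_nonneg_right (not_lt.1 hz) (abs_nonneg _)

/-- The proportion of the sample outside `[-K, K]`. -/
noncomputable def tailProportion (K : ℝ) (n : ℕ) (z : ℕ → ℝ) : ℝ :=
  (1 / (n : ℝ)) * ∑ j ∈ Finset.range n, ({z | K < |z|} : Set ℝ).indicator (fun _ => (1 : ℝ)) (z j)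

lemma measurableSet_abs_gt (K : ℝ) : MeasurableSet {z : ℝ | K < |z|} :=
  measurableSet_lt measurable_const (by fun_prop)

lemma norm_empCharFun_sub_le {K : ℝ} (hK : 0 ≤ K) {n : ℕ} (hn : n ≠ 0) (z : ℕ → ℝ) (s t : ℝ) :
    ‖empCharFun n z t - empCharFun n z s‖ ≤ K * |t - s| + 2 * tailProportion K n z := by
  have hn' : (n : ℝ) ≠ 0 := by exact_mod_cast hn
  rw [empCharFun, empCharFun, ← mul_sub, ← Finset.sum_sub_distrib, norm_mul, norm_div, norm_one,
    Complex.norm_natCast]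
  calc (1 / (n : ℝ)) * ‖∑ j ∈ Finset.range n, (Complex.exp (t * z j * Complex.I) -
        Complex.exp (s * z j * Complex.I))‖
      ≤ (1 / (n : ℝ)) * ∑ j ∈ Finset.range n, (K * |t - s| +
          2 * ({z | K < |z|} : Set ℝ).indicator (fun _ => (1 : ℝ)) (z j)) := by
        gcongr
        exact norm_sum_le_of_le _ fun j _ => norm_exp_sub_exp_le hK s t (z j)
    _ = _ := by
        rw [Finset.sum_add_distrib, Finset.sum_const, Finset.card_range, nsmul_eq_mul,
          ← Finset.mul_sum, tailProportion]
        field_simp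

lemma norm_charFun_sub_le {K : ℝ} (hK : 0 ≤ K) (s t : ℝ) :
    ‖charFun q t - charFun q s‖ ≤ K * |t - s| + 2 * q.real {z | K < |z|} := by
  have hi : ∀ u : ℝ, Integrable (fun x : ℝ => Complex.exp (u * x * Complex.I)) q := fun u =>
    Integrable.of_bound (Measurable.aestronglyMeasurable (by fun_prop)) 1
      (ae_of_all _ fun x => (norm_exp_mul_I u x).le)
  have hind : Integrable (({z | K < |z|} : Set ℝ).indicator (fun _ => (1 : ℝ))) q :=
    (integrable_const _).indicator (measurableSet_abs_gt K)
  rw [charFun_apply_real, charFun_apply_real, ← integral_sub (hi t) (hi s)]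
  refine (norm_integral_le_of_norm_le ((integrable_const (K * |t - s|)).add (hind.const_mul 2))
    (ae_of_all _ fun x => norm_exp_sub_exp_le hK s t x)).trans_eq ?_
  simp only [Pi.add_apply]
  rw [integral_add (integrable_const _) (hind.const_mul 2), integral_const_mul (2 : ℝ),
    integral_indicator (measurableSet_abs_gt K)]
  simp

lemma norm_empDeviation_sub_le {K : ℝ} (hK : 0 ≤ K) {n : ℕ} (hn : n ≠ 0) (z : ℕ → ℝ) (s t : ℝ) :
    ‖empDeviation q n z t - empDeviation q n z s‖ ≤
      2 * K * |t - s| + 2 * tailProportion K n z + 2 * q.real {z | K < |z|} := by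
  have h : empDeviation q n z t - empDeviation q n z s =
      (empCharFun n z t - empCharFun n z s) - (charFun q t - charFun q s) := by
    unfold empDeviation
    ring
  rw [h]
  refine (norm_sub_le _ _).trans ?_
  linarith [norm_empCharFun_sub_le hK hn z s t, norm_charFun_sub_le (q := q) hK s t]

lemma tendsto_measureReal_abs_gt :
    Tendsto (fun K : ℕ => q.real {z | (K : ℝ) < |z|}) atTop (𝓝 0) := by
  have h := tendsto_measure_iInter_atTop (μ := q) (s := fun K : ℕ => {z : ℝ | (K : ℝ) < |z|})
    (fun K => (measurableSet_abs_gt _).nullMeasurableSet)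
    (fun K L hKL z hz => lt_of_le_of_lt (b := (L : ℝ)) (Nat.cast_le.2 hKL) hz) ⟨0, measure_ne_top _ _⟩
  have h0 : (⋂ K : ℕ, {z : ℝ | (K : ℝ) < |z|}) = ∅ := by
    ext z
    simp only [Set.mem_iInter, Set.mem_ofPred_eq, Set.mem_empty_iff_false, iff_false, not_forall,
      not_lt]
    exact exists_nat_ge _
  rw [h0, measure_empty] at h
  have h2 := (ENNReal.tendsto_toReal ENNReal.zero_ne_top).comp h
  rw [ENNReal.toReal_zero] at h2
  exact h2

lemma tendsto_measureReal_tailProportion (hZ : IsPairwiseIIDSample P Z q) (K : ℝ) {δ : ℝ}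
    (hδ : 0 < δ) :
    Tendsto (fun n : ℕ => P.real {ω | q.real {z | K < |z|} + δ ≤
      tailProportion K n (fun k => Z k ω)}) atTop (𝓝 0) := by
  set F : ℝ → ℝ := ({z | K < |z|} : Set ℝ).indicator (fun _ => (1 : ℝ)) with hFdef
  have hF : Measurable F := measurable_const.indicator (measurableSet_abs_gt K)
  have hF1 : ∀ x, |F x| ≤ 1 := fun x => by
    rw [hFdef]
    by_cases hx : x ∈ ({z | K < |z|} : Set ℝ) <;> simp [hx]
  have hint : ∫ x, F x ∂q = q.real {z | K < |z|} := by
    rw [hFdef, integral_indicator (measurableSet_abs_gt K)]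
    simp
  have key : Tendsto (fun n : ℕ => P.real {ω | δ ^ 2 ≤
      (tailProportion K n (fun k => Z k ω) - q.real {z | K < |z|}) ^ 2}) atTop (𝓝 0) := by
    refine tendsto_measureReal_of_integral_le (b := fun n => 1 / (n : ℝ))
      (fun n ω => sq_nonneg _) (fun n => ?_) ?_ tendsto_one_div_atTop_nhds_zero_nat (by positivity)
    · have hL : MemLp (fun ω => ∑ j ∈ Finset.range n, F (Z j ω)) 2 P :=
        memLp_finsetSum _ fun j _ => MemLp.of_bound
          (hF.comp (hZ.measurable j)).aestronglyMeasurable 1 (ae_of_all _ fun _ => hF1 _)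
      have hL2 : MemLp (fun ω => tailProportion K n (fun k => Z k ω)) 2 P := hL.const_mul _
      exact (hL2.sub (memLp_const (q.real {z | K < |z|}))).integrable_sq
    · filter_upwards [eventually_ne_atTop 0] with n hn
      have h := integral_sq_empirical_sub_le hZ hF hF1 hn
      rw [hint] at h
      refine h.trans (mul_le_of_le_one_right (by positivity) ?_)
      have : ∫ x, F x ^ 2 ∂q ≤ ∫ x, (1 : ℝ) ∂q := by
        refine integral_mono_of_nonneg (ae_of_all _ fun _ => sq_nonneg _) (integrable_const _)
          (ae_of_all _ fun x => ?_)
        exact (sq_le_one_iff_abs_le_one _).2 (hF1 x)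
      simpa using this
  refine squeeze_zero (fun _ => measureReal_nonneg) (fun n => measureReal_mono fun ω hω => ?_) key
  rw [Set.mem_ofPred_eq] at hω ⊢
  gcongr
  linarith

/-- If the deviation is nowhere locally small around a point, its integral square is not small. -/
lemma norm_empDeviation_lt_of_integral_lt {R δ η : ℝ} {n : ℕ} {z : ℕ → ℝ} (hη0 : 0 < η)
    (hη1 : η ≤ 1) (hosc : ∀ s t, |t - s| ≤ η →
      ‖empDeviation q n z t - empDeviation q n z s‖ ≤ δ / 2)
    (hint : ∫ t in Set.Ioc (-(R + 1)) (R + 1), ‖empDeviation q n z t‖ ^ 2 < η * (δ / 2) ^ 2)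
    {s : ℝ} (hs : |s| ≤ R) : ‖empDeviation q n z s‖ < δ := by
  by_contra! hδ
  refine hint.not_ge ?_
  have hδ0 : 0 ≤ δ / 2 := (norm_nonneg _).trans (hosc s s (by simpa using hη0.le))
  have hc := continuous_empDeviation (q := q) n z
  have hi : ∀ a b : ℝ, IntegrableOn (fun t => ‖empDeviation q n z t‖ ^ 2) (Set.Ioc a b) := fun a b =>
    ((hc.norm.pow 2).integrableOn_Icc).mono_set Set.Ioc_subset_Icc_self
  -- The window is enlarged by `1 ≥ η` so that an interval of length `η` starting at any `|s| ≤ R`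
  -- fits inside.
  have hsub : Set.Ioc s (s + η) ⊆ Set.Ioc (-(R + 1)) (R + 1) := by
    obtain ⟨h1, h2⟩ := abs_le.1 hs
    exact Set.Ioc_subset_Ioc (by linarith) (by linarith)
  calc η * (δ / 2) ^ 2 = ∫ t in Set.Ioc s (s + η), (δ / 2) ^ 2 := by
        rw [setIntegral_const, Real.volume_real_Ioc_of_le (by linarith), smul_eq_mul]
        ring
    _ ≤ ∫ t in Set.Ioc s (s + η), ‖empDeviation q n z t‖ ^ 2 := by
        refine setIntegral_mono_on (by simp) (hi _ _) measurableSet_Ioc fun t ht => ?_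
        have h1 := hosc s t (by rw [abs_of_pos] <;> linarith [ht.1, ht.2])
        have h2 := norm_sub_norm_le (empDeviation q n z s) (empDeviation q n z t)
        rw [norm_sub_rev] at h2
        gcongr
        linarith
    _ ≤ _ := setIntegral_mono_set (hi _ _) (ae_of_all _ fun _ => by positivity)
        (LE.le.eventuallyLE hsub)

/-- Uniform convergence in probability of the empirical characteristic function on intervals
growing slower than the sample size. No moment condition is needed. -/
lemma tendsto_measureReal_exists_norm_empDeviation (hZ : IsPairwiseIIDSample P Z q)
    {R : ℕ → ℝ} (hR0 : ∀ᶠ n in atTop, 0 ≤ R n)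
    (hR : Tendsto (fun n : ℕ => R n / n) atTop (𝓝 0)) {δ : ℝ} (hδ : 0 < δ) :
    Tendsto (fun n : ℕ => P.real {ω | ∃ t, |t| ≤ R n ∧
      δ ≤ ‖empDeviation q n (fun k => Z k ω) t‖}) atTop (𝓝 0) := by
  -- The constants bound the oscillation at scale `η` by `δ/2`: the Lipschitz part gives `δ/4`, the
  -- sample tail `2(δ/32 + δ/16) = 3δ/16`, the tail of `q` another `δ/16`.
  obtain ⟨K, hK⟩ := ((tendsto_measureReal_abs_gt (q := q)).eventually
    (gt_mem_nhds (show (0 : ℝ) < δ / 32 by positivity))).exists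
  set η : ℝ := min 1 (δ / (8 * (K + 1))) with hη
  have hK0 : (0 : ℝ) ≤ K := Nat.cast_nonneg K
  have hη0 : 0 < η := lt_min one_pos (by positivity)
  have hKη : 2 * K * η ≤ δ / 4 := by
    have h1 : η ≤ δ / (8 * (K + 1)) := min_le_right _ _
    rw [le_div_iff₀ (by positivity)] at h1
    nlinarith
  have h1 := tendsto_measureReal_integral_norm_sq_empDeviation hZ (R := fun n => R n + 1)
    (hR0.mono fun n hn => by linarith)
    (by simpa [add_div] using hR.add tendsto_one_div_atTop_nhds_zero_nat)
    (show 0 < η * (δ / 2) ^ 2 by positivity)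
  have h2 := tendsto_measureReal_tailProportion hZ K (show (0 : ℝ) < δ / 16 by positivity)
  have h3 := h1.add h2
  rw [add_zero] at h3
  refine tendsto_of_tendsto_of_tendsto_of_le_of_le' tendsto_const_nhds h3
    (Eventually.of_forall fun _ => measureReal_nonneg) ?_
  filter_upwards [eventually_ne_atTop 0] with n hn
  refine le_trans (measureReal_mono fun ω hω => ?_) (measureReal_union_le _ _)
  obtain ⟨s, hs, hδs⟩ := hω
  by_contra hcon
  rw [Set.mem_union, not_or] at hcon
  obtain ⟨hc1, hc2⟩ := hcon
  rw [Set.mem_ofPred_eq, not_le] at hc1 hc2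
  refine hδs.not_gt (norm_empDeviation_lt_of_integral_lt hη0 (min_le_left _ _)
    (fun u t hut => ?_) hc1 hs)
  refine (norm_empDeviation_sub_le hK0 hn _ u t).trans ?_
  have : 2 * K * |t - u| ≤ 2 * K * η := by gcongr
  linarith

end SamplingConvergence

/-! ### Deterministic error analysis of the estimator -/

section Estimator

/-- The analytic facts about the summand density `f`, the kernel `w` and the law `q` of the nonzero
observations on which the estimator relies. -/
structure IsDecompoundingTriple (lam W : ℝ) (f w : ℝ → ℝ) (q : Measure ℝ) : Prop where
  lam_pos : 0 < lam
  exp_eq : ∀ t, ((Real.exp lam - 1 : ℝ) : ℂ) * charFun q t + 1 = Complex.exp (lam * fnCharFun f t)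
  continuous_f : Continuous f
  integrable_f : Integrable f
  norm_f_le : ∀ t, ‖fnCharFun f t‖ ≤ 1
  f_zero : fnCharFun f 0 = 1
  integrable_charFun : Integrable (fnCharFun f)
  continuous_w : Continuous (fnCharFun w)
  norm_w_le : ∀ t, ‖fnCharFun w t‖ ≤ W
  w_zero : fnCharFun w 0 = 1
  support_w : ∀ t : ℝ, 1 < |t| → fnCharFun w t = 0

/-- The error of `empPath` relative to `exp (lam * fnCharFun f)`. -/
noncomputable def relError (lam : ℝ) (f w : ℝ → ℝ) (q : Measure ℝ) (h : ℝ) (n : ℕ) (z : ℕ → ℝ)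
    (t : ℝ) : ℂ :=
  ((Real.exp lam - 1 : ℝ) : ℂ) * Complex.exp (-(lam * fnCharFun f t)) *
    (empDeviation q n z t * fnCharFun w (h * t) + charFun q t * (fnCharFun w (h * t) - 1))

/-- The weight in the linear term of the expansion of the estimator. -/
noncomputable def linearWeight (lam : ℝ) (f w : ℝ → ℝ) (h x t : ℝ) : ℂ :=
  Complex.exp (-((t : ℂ) * (x : ℂ) * Complex.I)) *
    (((Real.exp lam - 1 : ℝ) : ℂ) * Complex.exp (-(lam * fnCharFun f t)) * fnCharFun w (h * t))

lemma norm_exp_neg_mul_I (t x : ℝ) :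
    ‖Complex.exp (-((t : ℂ) * (x : ℂ) * Complex.I))‖ = 1 := by
  rw [← neg_mul, ← neg_mul, ← Complex.ofReal_neg, norm_exp_mul_I]

variable {lam W : ℝ} {f w : ℝ → ℝ} {q : Measure ℝ}

namespace IsDecompoundingTriple

lemma one_le_W (H : IsDecompoundingTriple lam W f w q) : 1 ≤ W := by
  simpa [H.w_zero] using H.norm_w_le 0

lemma exp_sub_one_pos (H : IsDecompoundingTriple lam W f w q) : 0 < Real.exp lam - 1 := by
  linarith [Real.add_one_lt_exp H.lam_pos.ne', H.lam_pos]

lemma norm_exp_neg_le (H : IsDecompoundingTriple lam W f w q) (t : ℝ) :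
    ‖Complex.exp (-(lam * fnCharFun f t))‖ ≤ Real.exp lam := by
  refine (Complex.norm_exp_le_exp_norm _).trans (Real.exp_le_exp.2 ?_)
  rw [norm_neg, norm_mul, Complex.norm_real, Real.norm_of_nonneg H.lam_pos.le]
  exact mul_le_of_le_one_right H.lam_pos.le (H.norm_f_le t)

lemma norm_factor_le (H : IsDecompoundingTriple lam W f w q) (t : ℝ) :
    ‖((Real.exp lam - 1 : ℝ) : ℂ) * Complex.exp (-(lam * fnCharFun f t))‖ ≤
      (Real.exp lam - 1) * Real.exp lam := by
  rw [norm_mul, Complex.norm_real, Real.norm_of_nonneg H.exp_sub_one_pos.le]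
  exact mul_le_mul_of_nonneg_left (H.norm_exp_neg_le t) H.exp_sub_one_pos.le

lemma continuous_charFun_f (H : IsDecompoundingTriple lam W f w q) : Continuous (fnCharFun f) :=
  continuous_fnCharFun H.integrable_f

lemma empPath_eq (H : IsDecompoundingTriple lam W f w q) (h : ℝ) (n : ℕ) (z : ℕ → ℝ) (t : ℝ) :
    empPath lam w h n z t =
      Complex.exp (lam * fnCharFun f t) * (1 + relError lam f w q h n z t) := by
  have h1 : Complex.exp (lam * fnCharFun f t) * Complex.exp (-(lam * fnCharFun f t)) = 1 := by
    rw [← Complex.exp_add, add_neg_cancel, Complex.exp_zero]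
  have h2 := H.exp_eq t
  have h3 : Complex.exp (lam * fnCharFun f t) * (1 + relError lam f w q h n z t) =
      Complex.exp (lam * fnCharFun f t) +
      (Complex.exp (lam * fnCharFun f t) * Complex.exp (-(lam * fnCharFun f t))) *
        (((Real.exp lam - 1 : ℝ) : ℂ) * (empCharFun n z t * fnCharFun w (h * t) - charFun q t)) := by
    rw [relError, empDeviation]
    ring
  rw [h3, h1, ← h2, empPath]
  ring

lemma norm_relError_le (H : IsDecompoundingTriple lam W f w q) (h : ℝ) (n : ℕ) (z : ℕ → ℝ)
    (t : ℝ) : ‖relError lam f w q h n z t‖ ≤ (Real.exp lam - 1) * Real.exp lam *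
      (‖empDeviation q n z t‖ * ‖fnCharFun w (h * t)‖ +
        ‖charFun q t‖ * ‖fnCharFun w (h * t) - 1‖) := by
  rw [relError, norm_mul]
  have h0 := mul_pos H.exp_sub_one_pos (Real.exp_pos lam)
  refine mul_le_mul (H.norm_factor_le t) ?_ (norm_nonneg _) h0.le
  refine (norm_add_le _ _).trans_eq ?_
  rw [norm_mul, norm_mul]

lemma empPath_ne_zero (H : IsDecompoundingTriple lam W f w q) {h : ℝ} {n : ℕ}
    {z : ℕ → ℝ} (hsmall : ∀ t, ‖relError lam f w q h n z t‖ ≤ 1 / 2) (t : ℝ) :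
    empPath lam w h n z t ≠ 0 := by
  rw [H.empPath_eq]
  refine mul_ne_zero (Complex.exp_ne_zero _) (Complex.slitPlane_ne_zero
    (Complex.mem_slitPlane_of_norm_lt_one ((hsmall t).trans_lt (by norm_num))))

/-- `φ_q` is a continuous function of `φ_f` vanishing where `φ_f = 0`, and `φ_f → 0` by
Riemann–Lebesgue. -/
lemma tendsto_charFun_q (H : IsDecompoundingTriple lam W f w q) :
    Tendsto (charFun q) (cocompact ℝ) (𝓝 0) := by
  have hE : ((Real.exp lam - 1 : ℝ) : ℂ) ≠ 0 := by exact_mod_cast H.exp_sub_one_pos.ne'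
  have h1 : charFun q = fun t => (Complex.exp (lam * fnCharFun f t) - 1) /
      ((Real.exp lam - 1 : ℝ) : ℂ) := by
    ext t
    rw [← H.exp_eq t]
    field_simp
    ring
  rw [h1]
  have h2 : Continuous fun u : ℂ => (Complex.exp (lam * u) - 1) / ((Real.exp lam - 1 : ℝ) : ℂ) := by
    fun_prop
  have h3 := (h2.tendsto 0).comp (tendsto_fnCharFun_cocompact f)
  simpa [Function.comp_def] using h3

lemma norm_linearWeight_le (H : IsDecompoundingTriple lam W f w q) (h x t : ℝ) :
    ‖linearWeight lam f w h x t‖ ≤ (Real.exp lam - 1) * Real.exp lam * W := by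
  rw [linearWeight, norm_mul, norm_exp_neg_mul_I, one_mul, norm_mul]
  have h0 := mul_pos H.exp_sub_one_pos (Real.exp_pos lam)
  exact mul_le_mul (H.norm_factor_le t) (H.norm_w_le _) (norm_nonneg _) h0.le

lemma continuous_linearWeight (H : IsDecompoundingTriple lam W f w q) (h x : ℝ) :
    Continuous (linearWeight lam f w h x) := by
  have h1 := H.continuous_charFun_f
  have h3 : Continuous fun t : ℝ => fnCharFun w (h * t) := H.continuous_w.comp (by fun_prop)
  unfold linearWeight
  fun_prop

variable [IsProbabilityMeasure q]

lemma continuous_relError (H : IsDecompoundingTriple lam W f w q) (h : ℝ) (n : ℕ) (z : ℕ → ℝ) :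
    Continuous (relError lam f w q h n z) := by
  have h1 := H.continuous_charFun_f
  have h2 := continuous_empDeviation (q := q) n z
  have h3 : Continuous fun t : ℝ => fnCharFun w (h * t) := H.continuous_w.comp (by fun_prop)
  have h4 : Continuous (charFun q) := continuous_charFun
  unfold relError
  fun_prop

lemma relError_zero (H : IsDecompoundingTriple lam W f w q) (h : ℝ) {n : ℕ} (hn : n ≠ 0)
    (z : ℕ → ℝ) : relError lam f w q h n z 0 = 0 := by
  have hn' : (n : ℂ) ≠ 0 := by exact_mod_cast hn
  simp [relError, empDeviation, empCharFun, H.w_zero, hn']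

lemma distinguishedLog_empPath (H : IsDecompoundingTriple lam W f w q) {h : ℝ} {n : ℕ}
    (hn : n ≠ 0) {z : ℕ → ℝ} (hsmall : ∀ t, ‖relError lam f w q h n z t‖ ≤ 1 / 2) :
    distinguishedLog (empPath lam w h n z) =
      fun t => lam * fnCharFun f t + Complex.log (1 + relError lam f w q h n z t) := by
  rw [funext (H.empPath_eq h n z)]
  refine distinguishedLog_exp_mul_one_add (continuous_const.mul H.continuous_charFun_f)
    (H.continuous_relError h n z) (fun t => (hsmall t).trans_lt (by norm_num))
    (H.relError_zero h hn z) ?_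
  simp [H.f_zero]

/-- From `|e^u - 1| ≤ |u| e^{|u|}` with `u = λ φ_f`, `φ_q` is dominated by a multiple of `φ_f`. -/
lemma integrable_charFun_q (H : IsDecompoundingTriple lam W f w q) : Integrable (charFun q) := by
  have hE := H.exp_sub_one_pos
  have hbd : ∀ t, ‖charFun q t‖ ≤
      (Real.exp lam - 1)⁻¹ * (lam * Real.exp lam) * ‖fnCharFun f t‖ := by
    intro t
    have h1 : ‖((Real.exp lam - 1 : ℝ) : ℂ) * charFun q t‖ ≤
        ‖lam * fnCharFun f t‖ * Real.exp ‖lam * fnCharFun f t‖ := by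
      have := Complex.norm_exp_sub_sum_le_norm_mul_exp (lam * fnCharFun f t) 1
      rw [← H.exp_eq t] at this
      simpa using this
    have h2 : ‖lam * fnCharFun f t‖ = lam * ‖fnCharFun f t‖ := by
      rw [norm_mul, Complex.norm_real, Real.norm_of_nonneg H.lam_pos.le]
    have h3 : Real.exp (lam * ‖fnCharFun f t‖) ≤ Real.exp lam :=
      Real.exp_le_exp.2 (mul_le_of_le_one_right H.lam_pos.le (H.norm_f_le t))
    rw [norm_mul, Complex.norm_real, Real.norm_of_nonneg hE.le, h2] at h1
    rw [mul_assoc, le_inv_mul_iff₀ hE]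
    refine h1.trans ?_
    have := mul_le_mul_of_nonneg_left h3 (mul_nonneg H.lam_pos.le (norm_nonneg (fnCharFun f t)))
    linarith
  exact (H.integrable_charFun.norm.const_mul _).mono' continuous_charFun.aestronglyMeasurable
    (ae_of_all _ hbd)

lemma integrable_bias (H : IsDecompoundingTriple lam W f w q) (h : ℝ) :
    Integrable fun t => ‖charFun q t‖ * ‖fnCharFun w (h * t) - 1‖ := by
  have h3 : Continuous fun t : ℝ => fnCharFun w (h * t) := H.continuous_w.comp (by fun_prop)
  have h4 : Continuous (charFun q) := continuous_charFun
  refine (H.integrable_charFun_q.norm.mul_const (W + 1)).mono'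
    (Continuous.aestronglyMeasurable (by fun_prop)) (ae_of_all _ fun t => ?_)
  rw [Real.norm_of_nonneg (by positivity)]
  gcongr
  refine (norm_sub_le _ _).trans ?_
  rw [norm_one]
  linarith [H.norm_w_le (h * t)]

/-- The error of the estimator in terms of the deviation of the empirical characteristic
function. -/
lemma abs_rawEstimator_sub_le (H : IsDecompoundingTriple lam W f w q) {h : ℝ} (hh : 0 < h) {n : ℕ}
    (hn : n ≠ 0) {z : ℕ → ℝ} (hsmall : ∀ t, ‖relError lam f w q h n z t‖ ≤ 1 / 2)
    {B : ℝ} (hB : B = (Real.exp lam - 1) * Real.exp lam) (x : ℝ) :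
    |rawEstimator lam w h n z x - f x| ≤ 1 / (2 * Real.pi * lam) *
      (‖∫ t in Set.Ioc (-(1 / h)) (1 / h), linearWeight lam f w h x t * empDeviation q n z t‖ +
        2 * (B * W) ^ 2 * (∫ t in Set.Ioc (-(1 / h)) (1 / h), ‖empDeviation q n z t‖ ^ 2) +
        (B + 2 * B ^ 2 * (W + 1)) * ∫ t, ‖charFun q t‖ * ‖fnCharFun w (h * t) - 1‖) +
      ‖1 / (2 * (Real.pi : ℂ)) * (∫ t in (-(1 / h))..(1 / h),
        Complex.exp (-((t : ℂ) * (x : ℂ) * Complex.I)) * fnCharFun f t) - f x‖ := by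
  have hR : -(1 / h) ≤ 1 / h := by
    have : 0 < 1 / h := by positivity
    linarith
  have hB0 : 0 < B := hB ▸ mul_pos H.exp_sub_one_pos (Real.exp_pos lam)
  have hW := H.one_le_W
  have hwc : Continuous fun t : ℝ => fnCharFun w (h * t) := H.continuous_w.comp (by fun_prop)
  have hqc : Continuous (charFun q) := continuous_charFun
  have hfc := H.continuous_charFun_f
  have hDc := continuous_empDeviation (q := q) n z
  have hrc := H.continuous_relError h n z
  have hac := H.continuous_linearWeight h x
  have hw1 : ∀ t, ‖fnCharFun w (h * t) - 1‖ ≤ W + 1 := fun t => by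
    refine (norm_sub_le _ _).trans ?_
    rw [norm_one]
    linarith [H.norm_w_le (h * t)]
  have hlogc : Continuous fun t => Complex.log (1 + relError lam f w q h n z t) :=
    (continuous_const.add hrc).clog fun t =>
      Complex.mem_slitPlane_of_norm_lt_one ((hsmall t).trans_lt (by norm_num))
  set e : ℝ → ℂ := fun t => Complex.exp (-((t : ℂ) * (x : ℂ) * Complex.I)) with he
  have hec : Continuous e := by fun_prop
  have hen : ∀ t, ‖e t‖ = 1 := fun t => norm_exp_neg_mul_I t x
  set b : ℝ → ℂ := fun t => e t * (((Real.exp lam - 1 : ℝ) : ℂ) *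
    Complex.exp (-(lam * fnCharFun f t)) * (charFun q t * (fnCharFun w (h * t) - 1))) with hb
  have hbc : Continuous b := by fun_prop
  set r : ℝ → ℂ := fun t => e t * (Complex.log (1 + relError lam f w q h n z t) -
    relError lam f w q h n z t) with hr
  have hrrc : Continuous r := hec.mul (hlogc.sub hrc)
  set bias : ℝ := ∫ t, ‖charFun q t‖ * ‖fnCharFun w (h * t) - 1‖ with hbias
  set I0 := ∫ t in (-(1 / h))..(1 / h), e t * fnCharFun f t with hI0
  set I1 := ∫ t in Set.Ioc (-(1 / h)) (1 / h), linearWeight lam f w h x t * empDeviation q n z t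
    with hI1
  set I2 := ∫ t in Set.Ioc (-(1 / h)) (1 / h), b t with hI2
  set I3 := ∫ t in Set.Ioc (-(1 / h)) (1 / h), r t with hI3
  set J := ∫ t in Set.Ioc (-(1 / h)) (1 / h), ‖empDeviation q n z t‖ ^ 2 with hJ
  -- `I0` is the inversion integral, `I1` and `I2` are the noise and bias parts of the linear term
  -- `ρ`, and `I3` carries the remainder `log (1 + ρ) - ρ`.
  have hsplit : (∫ t in (-(1 / h))..(1 / h), e t * distinguishedLog (empPath lam w h n z) t) =
      lam * I0 + I1 + I2 + I3 := by
    rw [H.distinguishedLog_empPath hn hsmall, hI1, hI2, hI3,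
      ← intervalIntegral.integral_of_le hR, ← intervalIntegral.integral_of_le hR,
      ← intervalIntegral.integral_of_le hR, hI0, ← intervalIntegral.integral_const_mul,
      ← intervalIntegral.integral_add, ← intervalIntegral.integral_add,
      ← intervalIntegral.integral_add]
    · congr 1
      ext t
      simp only [hr, hb, linearWeight, relError]
      ring
    all_goals exact Continuous.intervalIntegrable (by fun_prop) _ _
  have hbias_le : ∫ t in Set.Ioc (-(1 / h)) (1 / h), ‖charFun q t‖ * ‖fnCharFun w (h * t) - 1‖ ≤
      bias := setIntegral_le_integral (H.integrable_bias h) (ae_of_all _ fun t => by positivity)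
  have hI2_le : ‖I2‖ ≤ B * bias := by
    calc ‖I2‖ ≤ ∫ t in Set.Ioc (-(1 / h)) (1 / h),
          B * (‖charFun q t‖ * ‖fnCharFun w (h * t) - 1‖) := by
          refine norm_integral_le_of_norm_le ((H.integrable_bias h).restrict.const_mul B)
            (ae_of_all _ fun t => ?_)
          rw [hb, norm_mul, hen, one_mul, norm_mul, norm_mul (charFun q t), hB]
          exact mul_le_mul_of_nonneg_right (H.norm_factor_le t) (by positivity)
      _ ≤ _ := by
          rw [integral_const_mul]
          exact mul_le_mul_of_nonneg_left hbias_le hB0.le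
  have hDi : IntegrableOn (fun t => ‖empDeviation q n z t‖ ^ 2) (Set.Ioc (-(1 / h)) (1 / h)) :=
    ((hDc.norm.pow 2).integrableOn_Icc).mono_set Set.Ioc_subset_Icc_self
  have hr_le : ∀ t, ‖r t‖ ≤ 2 * (B * W) ^ 2 * ‖empDeviation q n z t‖ ^ 2 +
      2 * B ^ 2 * (W + 1) * (‖charFun q t‖ * ‖fnCharFun w (h * t) - 1‖) := by
    intro t
    set ρ := relError lam f w q h n z t with hρ
    -- The Taylor remainder is at most `|ρ|² / (2 (1 - |ρ|))`, and `|ρ| ≤ 1/2` makes this at most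
    -- `|ρ|²`.
    have h1 : ‖r t‖ ≤ ‖ρ‖ ^ 2 := by
      rw [hr, norm_mul, hen, one_mul]
      have hlt : ‖ρ‖ < 1 := (hsmall t).trans_lt (by norm_num)
      refine (Complex.norm_log_one_add_sub_self_le hlt).trans ?_
      have h2 : (1 - ‖ρ‖)⁻¹ ≤ 2 := by
        rw [inv_le_comm₀ (by linarith) (by norm_num)]
        linarith [hsmall t]
      nlinarith [sq_nonneg ‖ρ‖]
    set d := ‖empDeviation q n z t‖
    set c := ‖charFun q t‖ * ‖fnCharFun w (h * t) - 1‖ with hc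
    have hd0 : 0 ≤ d := norm_nonneg _
    have hc0 : 0 ≤ c := by positivity
    have hcW : c ≤ W + 1 := by
      have := mul_le_mul (norm_charFun_le_one (μ := q) t) (hw1 t) (norm_nonneg _) zero_le_one
      rwa [one_mul] at this
    have h2 : ‖ρ‖ ≤ B * (d * W + c) := by
      refine (H.norm_relError_le h n z t).trans ?_
      rw [← hB]
      gcongr
      exact H.norm_w_le _
    calc ‖r t‖ ≤ (B * (d * W + c)) ^ 2 := h1.trans (by gcongr)
      _ ≤ 2 * (B * W) ^ 2 * d ^ 2 + 2 * B ^ 2 * c ^ 2 := by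
          have := mul_nonneg (sq_nonneg B) (sq_nonneg (d * W - c))
          nlinarith
      -- Since `c ≤ W + 1`, the squared bias is traded for a linear one, so only its integral is
      -- needed.
      _ ≤ 2 * (B * W) ^ 2 * d ^ 2 + 2 * B ^ 2 * ((W + 1) * c) := by
          have : c ^ 2 ≤ (W + 1) * c := by rw [pow_two]; gcongr
          gcongr
      _ = _ := by ring
  have hI3_le : ‖I3‖ ≤ 2 * (B * W) ^ 2 * J + 2 * B ^ 2 * (W + 1) * bias := by
    have hbi := (H.integrable_bias h).restrict (s := Set.Ioc (-(1 / h)) (1 / h))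
    refine (norm_integral_le_of_norm_le ((hDi.const_mul (2 * (B * W) ^ 2)).add
      (hbi.const_mul (2 * B ^ 2 * (W + 1)))) (ae_of_all _ hr_le)).trans ?_
    simp only [Pi.add_apply]
    rw [integral_add (hDi.const_mul _) (hbi.const_mul _), integral_const_mul, integral_const_mul]
    gcongr
  have hpi : (Real.pi : ℂ) ≠ 0 := by exact_mod_cast Real.pi_ne_zero
  have hlam : (lam : ℂ) ≠ 0 := by exact_mod_cast H.lam_pos.ne'
  have hraw : rawEstimator lam w h n z x - f x = ((1 / (2 * (Real.pi : ℂ) * lam)) * (I1 + I2 + I3) +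
      (1 / (2 * (Real.pi : ℂ)) * I0 - f x)).re := by
    rw [rawEstimator, if_pos (H.empPath_ne_zero hsmall), hsplit]
    rw [← Complex.ofReal_re (f x), ← Complex.sub_re, Complex.ofReal_re]
    congr 1
    field_simp
    ring
  rw [hraw]
  refine (Complex.abs_re_le_norm _).trans ((norm_add_le _ _).trans ?_)
  gcongr
  rw [norm_mul]
  have hc : ‖1 / (2 * (Real.pi : ℂ) * lam)‖ = 1 / (2 * Real.pi * lam) := by
    rw [norm_div, norm_mul, norm_mul, norm_one, Complex.norm_real, Complex.norm_real,
      Real.norm_of_nonneg H.lam_pos.le, Real.norm_of_nonneg Real.pi_pos.le, Complex.norm_ofNat]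
  rw [hc]
  have := H.lam_pos
  gcongr
  refine (norm_add₃_le).trans ?_
  linarith

end IsDecompoundingTriple

end Estimator

/-! ### Vanishing of the error terms and consistency -/

section Consistency

/-- Truncation fixes `y` and is 1-Lipschitz. -/
lemma abs_truncate_sub_le {M u y : ℝ} (hM : |y| ≤ M) : |max (min M u) (-M) - y| ≤ |u - y| := by
  obtain ⟨h1, h2⟩ := abs_le.1 hM
  have h3 : max (min M y) (-M) = y := by rw [min_eq_right h2, max_eq_left h1]
  calc |max (min M u) (-M) - y| = |max (min M u) (-M) - max (min M y) (-M)| := by rw [h3]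
    _ ≤ |min M u - min M y| := abs_max_sub_max_le_abs _ _ _
    _ ≤ |u - y| := by
      rw [min_comm M u, min_comm M y]
      exact abs_min_sub_min_le_max u M y M |>.trans (by simp)

namespace IsDecompoundingTriple

variable {lam W : ℝ} {f w : ℝ → ℝ} {q : Measure ℝ}

lemma tendsto_inversion (H : IsDecompoundingTriple lam W f w q) {R : ℕ → ℝ}
    (hR : Tendsto R atTop atTop) (x : ℝ) :
    Tendsto (fun n => ‖1 / (2 * (Real.pi : ℂ)) * (∫ t in (-(R n))..(R n),
        Complex.exp (-((t : ℂ) * (x : ℂ) * Complex.I)) * fnCharFun f t) - f x‖) atTop (𝓝 0) := by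
  have hi : Integrable fun t : ℝ =>
      Complex.exp (-((t : ℂ) * (x : ℂ) * Complex.I)) * fnCharFun f t := by
    refine H.integrable_charFun.norm.mono' (Continuous.aestronglyMeasurable ?_)
      (ae_of_all _ fun t => ?_)
    · have := H.continuous_charFun_f
      fun_prop
    · rw [norm_mul, norm_exp_neg_mul_I, one_mul]
  have h1 := intervalIntegral_tendsto_integral hi (tendsto_neg_atTop_atBot.comp hR) hR
  rw [integral_exp_mul_fnCharFun H.continuous_f H.integrable_f H.integrable_charFun] at h1
  have h2 := ((h1.const_mul (1 / (2 * (Real.pi : ℂ)))).sub_const (f x : ℂ)).norm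
  have hpi : (Real.pi : ℂ) ≠ 0 := by exact_mod_cast Real.pi_ne_zero
  have h3 : 1 / (2 * (Real.pi : ℂ)) * (2 * (Real.pi : ℂ) * (f x : ℂ)) - f x = 0 := by
    field_simp
    ring
  rwa [h3, norm_zero] at h2

variable [IsProbabilityMeasure q]

lemma tendsto_integral_bias (H : IsDecompoundingTriple lam W f w q) {h : ℕ → ℝ}
    (hh : Tendsto h atTop (𝓝 0)) :
    Tendsto (fun n => ∫ t, ‖charFun q t‖ * ‖fnCharFun w (h n * t) - 1‖) atTop (𝓝 0) := by
  have hlim := tendsto_integral_of_dominated_convergence (μ := volume)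
    (F := fun n t => ‖charFun q t‖ * ‖fnCharFun w (h n * t) - 1‖) (f := fun _ => (0 : ℝ))
    (fun t => ‖charFun q t‖ * (W + 1)) (fun n => (H.integrable_bias (h n)).aestronglyMeasurable)
    (H.integrable_charFun_q.norm.mul_const _) (fun n => ae_of_all _ fun t => ?_)
    (ae_of_all _ fun t => ?_)
  · simpa using hlim
  · rw [Real.norm_of_nonneg (by positivity)]
    gcongr
    refine (norm_sub_le _ _).trans ?_
    rw [norm_one]
    linarith [H.norm_w_le (h n * t)]
  · have h1 : Tendsto (fun n => h n * t) atTop (𝓝 0) := by simpa using hh.mul_const t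
    have h2 := ((H.continuous_w.tendsto 0).comp h1).sub_const 1
    rw [H.w_zero, sub_self] at h2
    simpa using h2.norm.const_mul ‖charFun q t‖

/-- Outside a large ball `φ_q` is small and the other factor is at most `W + 1`; inside it `h n * t`
is uniformly near `0`, where `φ_w` is near `1`. -/
lemma eventually_bias_le (H : IsDecompoundingTriple lam W f w q) {h : ℕ → ℝ}
    (hh : Tendsto h atTop (𝓝 0)) {δ : ℝ} (hδ : 0 < δ) :
    ∀ᶠ n in atTop, ∀ t, ‖charFun q t‖ * ‖fnCharFun w (h n * t) - 1‖ ≤ δ := by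
  have hW := H.one_le_W
  have h1 : ∀ᶠ t in cocompact ℝ, ‖charFun q t‖ < δ / (W + 1) := by
    have := H.tendsto_charFun_q.norm
    rw [norm_zero] at this
    exact this.eventually (gt_mem_nhds (by positivity))
  rw [← Metric.cobounded_eq_cocompact, (Metric.hasBasis_cobounded_compl_closedBall
    (0 : ℝ)).eventually_iff] at h1
  obtain ⟨T, -, hT⟩ := h1
  have h2 : ∀ᶠ u in 𝓝 (0 : ℝ), ‖fnCharFun w u - 1‖ < δ := by
    have h := ((H.continuous_w.tendsto 0).sub_const 1).norm
    rw [H.w_zero, sub_self, norm_zero] at h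
    exact h.eventually (gt_mem_nhds hδ)
  obtain ⟨η, hη, hηδ⟩ := Metric.eventually_nhds_iff.1 h2
  have h3 : ∀ᶠ n in atTop, |h n| * (|T| + 1) < η := by
    have : Tendsto (fun n => |h n| * (|T| + 1)) atTop (𝓝 0) := by
      simpa using hh.abs.mul_const (|T| + 1)
    exact this.eventually (gt_mem_nhds hη)
  filter_upwards [h3] with n hn t
  by_cases ht : t ∈ Metric.closedBall (0 : ℝ) T
  · have ht' : |t| ≤ |T| + 1 := by
      rw [mem_closedBall_zero_iff, Real.norm_eq_abs] at ht
      linarith [le_abs_self T]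
    have h4 : dist (h n * t) 0 < η := by
      rw [dist_zero_right, norm_mul, Real.norm_eq_abs, Real.norm_eq_abs]
      exact (mul_le_mul_of_nonneg_left ht' (abs_nonneg _)).trans_lt hn
    refine (mul_le_of_le_one_left (norm_nonneg _) (norm_charFun_le_one t)).trans (hηδ h4).le
  · have h4 := (hT ht).le
    have h5 : ‖fnCharFun w (h n * t) - 1‖ ≤ W + 1 := by
      refine (norm_sub_le _ _).trans ?_
      rw [norm_one]
      linarith [H.norm_w_le (h n * t)]
    calc ‖charFun q t‖ * ‖fnCharFun w (h n * t) - 1‖ ≤ δ / (W + 1) * (W + 1) := by gcongr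
      _ = δ := by field_simp

/-- Consistency of the estimator for a pairwise independent sample. -/
lemma tendstoInMeasure_decompoundingEstimator (H : IsDecompoundingTriple lam W f w q)
    {Ω : Type*} [MeasurableSpace Ω] {P : Measure Ω} [IsProbabilityMeasure P] {Z : ℕ → Ω → ℝ}
    (hZ : IsPairwiseIIDSample P Z q) {h M : ℕ → ℝ} (hpos : ∀ᶠ n in atTop, 0 < h n)
    (hh : Tendsto h atTop (𝓝 0)) (hnh : Tendsto (fun n : ℕ => 1 / h n / n) atTop (𝓝 0))
    (hM : Tendsto M atTop atTop) (x : ℝ) :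
    TendstoInMeasure P (fun (n : ℕ) (ω : Ω) =>
      decompoundingEstimator lam w (h n) (M n) n (fun k => Z k ω) x) atTop (fun _ => f x) := by
  rw [tendstoInMeasure_iff_measureReal_norm]
  intro ε hε
  have hlam := H.lam_pos
  have hpi := Real.pi_pos
  have hW := H.one_le_W
  obtain ⟨B, hB⟩ : ∃ B, B = (Real.exp lam - 1) * Real.exp lam := ⟨_, rfl⟩
  have hB0 : 0 < B := hB ▸ mul_pos H.exp_sub_one_pos (Real.exp_pos lam)
  have hR : Tendsto (fun n => 1 / h n) atTop atTop := by
    simp_rw [one_div]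
    exact (tendsto_nhdsWithin_iff.2 ⟨hh, hpos⟩).inv_tendsto_nhdsGT_zero
  have hR0 : ∀ᶠ n in atTop, 0 ≤ 1 / h n := hpos.mono fun n hn => by positivity
  set c : ℝ := 1 / (2 * Real.pi * lam) with hc
  have hc0 : 0 < c := by positivity
  -- `δ` makes the noise part of `|ρ|` at most `1/4`, the bias part being made at most `1/4` too;
  -- `δ₁` and `δ₂` bring the linear and quadratic error terms down to `ε/4` each.
  set δ : ℝ := 1 / (4 * B * W) with hδ
  have hδ0 : 0 < δ := by positivity
  set δ₁ : ℝ := ε / (4 * c) with hδ₁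
  have hδ₁0 : 0 < δ₁ := by positivity
  set δ₂ : ℝ := ε / (4 * c * (2 * (B * W) ^ 2)) with hδ₂
  have hδ₂0 : 0 < δ₂ := by positivity
  have e1 := tendsto_measureReal_exists_norm_empDeviation hZ hR0 hnh hδ0
  have e2 := tendsto_measureReal_norm_integral_mul_empDeviation hZ H.integrable_charFun_q hR0 hnh
    (a := fun n => linearWeight lam f w (h n) x)
    (fun n => (H.continuous_linearWeight (h n) x).measurable)
    (fun n t => H.norm_linearWeight_le (h n) x t) hδ₁0
  have e3 := tendsto_measureReal_integral_norm_sq_empDeviation hZ hR0 hnh hδ₂0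
  have e4 : Tendsto (fun n => c * ((B + 2 * B ^ 2 * (W + 1)) *
      ∫ t, ‖charFun q t‖ * ‖fnCharFun w (h n * t) - 1‖)) atTop (𝓝 0) := by
    simpa using ((H.tendsto_integral_bias hh).const_mul (B + 2 * B ^ 2 * (W + 1))).const_mul c
  have e123 := (e1.add e2).add e3
  rw [add_zero, add_zero] at e123
  refine tendsto_of_tendsto_of_tendsto_of_le_of_le' tendsto_const_nhds e123
    (Eventually.of_forall fun _ => measureReal_nonneg) ?_
  filter_upwards [hpos, eventually_ne_atTop 0, hM.eventually_ge_atTop |f x|,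
    H.eventually_bias_le hh (show 0 < 1 / (4 * B) by positivity),
    e4.eventually (gt_mem_nhds (show 0 < ε / 4 by positivity)),
    (H.tendsto_inversion hR x).eventually (gt_mem_nhds (show 0 < ε / 4 by positivity))]
    with n hn hn0 hMn hbias hb4 hinv
  refine le_trans (measureReal_mono fun ω hω => ?_) ((measureReal_union_le _ _).trans
    (add_le_add_left (measureReal_union_le _ _) _))
  by_contra hcon
  rw [Set.mem_union, Set.mem_union, not_or, not_or] at hcon
  obtain ⟨⟨hc1, hc2⟩, hc3⟩ := hcon
  simp only [Set.mem_ofPred_eq, not_exists, not_and, not_le] at hc1 hc2 hc3 hω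
  have hsmall : ∀ t, ‖relError lam f w q (h n) n (fun k => Z k ω) t‖ ≤ 1 / 2 := by
    intro t
    refine (H.norm_relError_le (h n) n _ t).trans ?_
    rw [← hB]
    have h1 : ‖empDeviation q n (fun k => Z k ω) t‖ * ‖fnCharFun w (h n * t)‖ ≤ δ * W := by
      by_cases ht : |t| ≤ 1 / h n
      · have h2 := (hc1 t ht).le
        have h3 := H.norm_w_le (h n * t)
        gcongr
      -- Beyond `|t| = 1/h` the kernel factor vanishes, so control of the deviation on the window
      -- controls `ρ` on the whole line.
      · rw [H.support_w, norm_zero, mul_zero]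
        · positivity
        · rw [not_le, div_lt_iff₀ hn] at ht
          rwa [abs_mul, abs_of_pos hn, mul_comm]
    calc B * (_ + _) ≤ B * (δ * W + 1 / (4 * B)) := by
          gcongr
          exact hbias t
      _ = 1 / 2 := by
          rw [hδ]
          field_simp
          norm_num
  have hest := H.abs_rawEstimator_sub_le hn hn0 hsmall hB x
  have htr : |decompoundingEstimator lam w (h n) (M n) n (fun k => Z k ω) x - f x| ≤
      |rawEstimator lam w (h n) n (fun k => Z k ω) x - f x| := abs_truncate_sub_le hMn
  rw [Real.norm_eq_abs] at hω
  have h1 : c * ‖∫ t in Set.Ioc (-(1 / h n)) (1 / h n), linearWeight lam f w (h n) x t *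
      empDeviation q n (fun k => Z k ω) t‖ ≤ ε / 4 := by
    calc _ ≤ c * δ₁ := by gcongr
      _ = ε / 4 := by rw [hδ₁]; field_simp
  have h2 : c * (2 * (B * W) ^ 2 * ∫ t in Set.Ioc (-(1 / h n)) (1 / h n),
      ‖empDeviation q n (fun k => Z k ω) t‖ ^ 2) ≤ ε / 4 := by
    calc _ ≤ c * (2 * (B * W) ^ 2 * δ₂) := by gcongr
      _ = ε / 4 := by rw [hδ₂]; field_simp
  rw [← hc, mul_add, mul_add] at hest
  linarith

end IsDecompoundingTriple

lemma isProbabilityMeasure_cond_compl_zero {μ : Measure ℝ} [IsFiniteMeasure μ]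
    (h : μ {0}ᶜ ≠ 0) : IsProbabilityMeasure μ[|{0}ᶜ] := cond_isProbabilityMeasure h

lemma integrable_of_isProbabilityMeasure_withDensity {f : ℝ → ℝ} (hf : Measurable f)
    (hf0 : ∀ y, 0 ≤ f y)
    (h : IsProbabilityMeasure (volume.withDensity fun y => ENNReal.ofReal (f y))) :
    Integrable f ∧ ∫ y, f y = 1 := by
  have h1 : ∫⁻ y, ENNReal.ofReal (f y) = 1 := by
    have := h.measure_univ
    rwa [withDensity_apply _ MeasurableSet.univ, Measure.restrict_univ] at this
  constructor
  · rw [← lintegral_ofReal_ne_top_iff_integrable hf.aestronglyMeasurable (ae_of_all _ hf0), h1]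
    exact ENNReal.one_ne_top
  · rw [integral_eq_lintegral_of_nonneg_ae (ae_of_all _ hf0) hf.aestronglyMeasurable, h1,
      ENNReal.toReal_one]

theorem corollary2p1
    {Ω₀ : Type*} [MeasurableSpace Ω₀] (P₀ : Measure Ω₀) [IsProbabilityMeasure P₀]
    {Ω : Type*} [MeasurableSpace Ω] (P : Measure Ω) [IsProbabilityMeasure P]
    -- the random sum `N ↦ Y 0 + … + Y (N - 1)`, and independent observations `X 0, X 1, …` on it
    (lam : ℝ) (hlam : 0 < lam)
    (f : ℝ → ℝ) (hf_nonneg : ∀ y, 0 ≤ f y)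
    (N : Ω₀ → ℕ) (Y : ℕ → Ω₀ → ℝ) (hmodel : IsCompoundPoissonModel P₀ lam f N Y)
    (X : ℕ → Ω → ℝ) (hX_indep : iIndepFun X P)
    (hX_law : ∀ i, IdentDistrib (X i) (randomSum N Y) P P₀)
    -- the conditions on the density, the kernel, the bandwidth and the truncating sequence
    (β L₁ L₂ : ℝ) (hβ : 0 < β) (hL₁ : 0 < L₁) (hL₂ : 0 < L₂)
    (hF : DensityCondition β L₁ L₂ f)
    (w : ℝ → ℝ) (hW : KernelCondition β w)
    (h : ℕ → ℝ) (hH : BandwidthCondition h)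
    (M : ℕ → ℝ) (hM : TruncationCondition M)
    (hnh : Tendsto (fun n : ℕ => (n : ℝ) * h n ^ (1 + 4 * β)) atTop (𝓝 0)) :
    ∀ x : ℝ, TendstoInMeasure P
      (fun (n : ℕ) (ω : Ω) =>
        decompoundingEstimator lam w (h n) (M n) n (fun k => nonzeroObs X k ω) x)
      atTop (fun _ => f x) := by
  intro x
  have hfc := hF.holder.continuous hβ
  have hlaw : IsProbabilityMeasure (volume.withDensity fun y => ENNReal.ofReal (f y)) := by
    rw [← (hmodel.law_summand 0).map_eq]
    exact Measure.isProbabilityMeasure_map (hmodel.law_summand 0).aemeasurable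
  obtain ⟨hfi, hf1⟩ := integrable_of_isProbabilityMeasure_withDensity hfc.measurable hf_nonneg hlaw
  have hS : AEMeasurable (randomSum N Y) P₀ := (hX_law 0).aemeasurable_snd
  obtain ⟨hμ, hq⟩ := charFun_cond_randomSum hlam hfc.measurable hf_nonneg hmodel hS
  have hwi : Integrable w := by simpa using hW.kernel.integrable_pow_mul 0 (Nat.zero_le _)
  have hμP := Measure.isProbabilityMeasure_map hS
  have hqP := isProbabilityMeasure_cond_compl_zero hμ
  have H : IsDecompoundingTriple lam (∫ u, |w u|) f w ((P₀.map (randomSum N Y))[|{0}ᶜ]) :=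
    { lam_pos := hlam
      exp_eq := hq
      continuous_f := hfc
      integrable_f := hfi
      norm_f_le := fun t => by
        refine (norm_fnCharFun_le f t).trans_eq ?_
        simp_rw [abs_of_nonneg (hf_nonneg _)]
        exact hf1
      f_zero := by rw [fnCharFun_zero, hf1, Complex.ofReal_one]
      integrable_charFun := integrable_fnCharFun_of_rpow hβ.le hfi hF.integrable_charFun
      continuous_w := continuous_fnCharFun hwi
      norm_w_le := norm_fnCharFun_le w
      w_zero := by rw [fnCharFun_zero, hW.kernel.integral_eq_one, Complex.ofReal_one]
      support_w := hW.charFun_support }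
  have hXm : ∀ i, AEMeasurable (X i) P := fun i => (hX_law i).aemeasurable_fst
  -- Identical distribution only gives almost everywhere measurability, whereas the random index
  -- `Nat.nth` is handled for measurable terms. The modifications agree with all `X i`
  -- simultaneously off one null set, hence have the same nonzero observations there.
  set X' : ℕ → Ω → ℝ := fun i => (hXm i).mk (X i)
  have hX'm : ∀ i, Measurable (X' i) := fun i => (hXm i).measurable_mk
  have hX'i : iIndepFun X' P := hX_indep.congr fun i => (hXm i).ae_eq_mk
  have hX'law : ∀ i, P.map (X' i) = P₀.map (randomSum N Y) := fun i => by
    rw [← (hX_law i).map_eq]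
    exact (Measure.map_congr (hXm i).ae_eq_mk).symm
  have hZ : IsPairwiseIIDSample P (nonzeroObs X') ((P₀.map (randomSum N Y))[|{0}ᶜ]) :=
    ⟨measurable_nonzeroObs hX'm, map_nonzeroObs hX'm hX'i hX'law hμ,
      fun j k hjk => indepFun_nonzeroObs hX'm hX'i hX'law hμ hjk⟩
  obtain ⟨C, γ, hC, hγ0, hγ1, hh⟩ := hH
  obtain ⟨α, hα, hMα⟩ := hM
  have hcast : Tendsto (fun n : ℕ => (n : ℝ)) atTop atTop := tendsto_natCast_atTop_atTop
  have hpos : ∀ᶠ n in atTop, 0 < h n := by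
    filter_upwards [eventually_ge_atTop 1] with n hn
    have : (0 : ℝ) < n := by exact_mod_cast hn
    rw [hh n hn]
    positivity
  have hh0 : Tendsto h atTop (𝓝 0) := by
    have h1 := ((tendsto_rpow_neg_atTop hγ0).comp hcast).const_mul C
    rw [mul_zero] at h1
    refine h1.congr' ?_
    filter_upwards [eventually_ge_atTop 1] with n hn
    exact (hh n hn).symm
  have hhn : Tendsto (fun n : ℕ => 1 / h n / n) atTop (𝓝 0) := by
    -- Here `1/(n h n) = C⁻¹ n^{-(1 - γ)}`, which is where `γ < 1` enters.
    have h1 := ((tendsto_rpow_neg_atTop (show 0 < 1 - γ by linarith)).comp hcast).const_mul C⁻¹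
    rw [mul_zero] at h1
    refine h1.congr' ?_
    filter_upwards [eventually_ge_atTop 1] with n hn
    have hn0 : (0 : ℝ) < n := by exact_mod_cast hn
    rw [hh n hn, Function.comp_apply, neg_sub, Real.rpow_sub hn0, Real.rpow_one, Real.rpow_neg hn0.le]
    field_simp
  have hMt : Tendsto M atTop atTop := by
    refine ((tendsto_rpow_atTop hα).comp hcast).congr' ?_
    filter_upwards [eventually_ge_atTop 1] with n hn
    exact (hMα n hn).symm
  refine (H.tendstoInMeasure_decompoundingEstimator hZ hpos hh0 hhn hMt x).congr_left fun n => ?_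
  filter_upwards [ae_all_iff.2 fun i => (hXm i).ae_eq_mk] with ω hω
  have : ∀ k, nonzeroObs X' k ω = nonzeroObs X k ω := fun k => by
    simp only [nonzeroObs, X', ← hω]
  simp_rw [this]

end Consistency
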